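/- For a finite graph $G$ with at least two vertices and $S\subseteq V(G)$, let $N(S)$ be the set of vertices in $V(G)\setminus S$ that are adjacent to at least one vertex in $S$, and let $$i(G)=\min\left\{\frac{|N(S)|}{|S|} : \emptyset\neq S\subseteq V(G),\ |S|\le \frac{|V(G)|}{2}\right\}$$ be the vertex-isoperimetric number of $G$. Let $q>2$ be a prime power, and let $H(q)$ be the classical (Hermitian) unital of order $q$: its points are the absolute points of a unitary polarity of the Desarguesian projective plane $\mathrm{PG}(2,q^2)$ (that is, a polarity that takes each point to its orthogonal complement with respect to a non-degenerate Hermitian form on $\mathbb F_{q^2}^3$), and its blocks are the sets of points of $H(q)$ on the non-absolute lines. (A point is absolute if it lies on its image under the polarity, and a line is absolute if it is the image of a point lying on it.) Let $G_{H(q)}$ be the incidence graph of $H(q)$, i.e. the bipartite graph whose vertices are the points and the blocks of $H(q)$, with a point $p$ adjacent to a block $B$ if and only if $p\in B$. Put $$c(q)=q^2-\frac{\sqrt{8q^2+9}-3}{2}.$$ Then $$i(G_{H(q)})=\frac{2\left(q^3+1-\lfloor c(q)\rfloor\right)}{q^2(q^2+1)}.$$ -/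

import Mathlib

open scoped LinearAlgebra.Projectivization Matrix

/-! ### Vertex-isoperimetric number -/

/-- The neighbourhood `N(S)`: the vertices outside `S` adjacent to some vertex of `S`. -/
def vertexNeighbourhood {V : Type*} (G : SimpleGraph V) (S : Set V) : Set V :=
  {v | v ∉ S ∧ ∃ u ∈ S, G.Adj u v}

/-- The ratios `|N(S)| / |S|`, over the non-empty `S` with `|S| ≤ |V| / 2`. -/
def vertexExpansionRatios {V : Type*} [Finite V] (G : SimpleGraph V) : Set ℝ :=
  {r | ∃ S : Set V, S.Nonempty ∧ (S.ncard : ℝ) ≤ (Nat.card V : ℝ) / 2 ∧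
    r = ((vertexNeighbourhood G S).ncard : ℝ) / (S.ncard : ℝ)}

/-- The vertex-isoperimetric number `i(G)` of a finite graph. The infimum is a minimum as soon as
the graph has two vertices, see `isLeast_vertexIsoperimetricNumber`. -/
noncomputable def vertexIsoperimetricNumber {V : Type*} [Finite V] (G : SimpleGraph V) : ℝ :=
  sInf (vertexExpansionRatios G)

theorem isLeast_vertexIsoperimetricNumber {V : Type*} [Finite V] (G : SimpleGraph V)
    (hV : 2 ≤ Nat.card V) :
    IsLeast (vertexExpansionRatios G) (vertexIsoperimetricNumber G) := by
  have hfin : (vertexExpansionRatios G).Finite := by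
    refine (Set.finite_range fun S : Set V =>
      ((vertexNeighbourhood G S).ncard : ℝ) / (S.ncard : ℝ)).subset ?_
    rintro r ⟨S, -, -, rfl⟩
    exact ⟨S, rfl⟩
  have hne : (vertexExpansionRatios G).Nonempty := by
    have : Nonempty V := (Nat.card_pos_iff.1 (by omega)).1
    obtain ⟨v⟩ := this
    refine ⟨_, {v}, Set.singleton_nonempty v, ?_, rfl⟩
    have : (2 : ℝ) ≤ (Nat.card V : ℝ) := by exact_mod_cast hV
    rw [Set.ncard_singleton]
    push_cast
    linarith
  exact ⟨hne.csInf_mem hfin, fun r hr => csInf_le hfin.bddBelow hr⟩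

/-! ### Incidence graphs -/

/-- The incidence graph of the incidence structure with point set `P` and block set `𝓑`. -/
def incidenceGraph {P : Type*} (𝓑 : Set (Set P)) : SimpleGraph (P ⊕ 𝓑) where
  Adj
    | Sum.inl p, Sum.inr B => p ∈ B.1
    | Sum.inr B, Sum.inl p => p ∈ B.1
    | _, _ => False
  symm := ⟨by
    rintro (p | B) (p' | B') h
    all_goals exact h⟩
  loopless := ⟨by
    rintro (p | B) h
    all_goals exact h⟩

/-! ### The plane `PG(2, F)`, unitary polarities and classical unitals -/

/-- The points of `PG(2, F)`. -/
abbrev PGPoint (F : Type*) [Field F] : Type _ := ℙ F (Fin 3 → F)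

/-- The lines of `PG(2, F)`: the two-dimensional subspaces of `F³`. -/
abbrev PGLine (F : Type*) [Field F] : Type _ :=
  {L : Submodule F (Fin 3 → F) // Module.finrank F L = 2}

/-- The point `p` lies on the line `L`. -/
def PGOn {F : Type*} [Field F] (p : PGPoint F) (L : PGLine F) : Prop :=
  p.submodule ≤ L.1

/-- The map `π` from points to lines is a unitary polarity of `PG(2, F)`, where `|F| = q²`: for
some non-degenerate Hermitian form `(y, x) ↦ ∑ yᵢ Aᵢⱼ xⱼ^q` it takes each point to its orthogonal
complement. -/
def IsUnitaryPolarity {F : Type*} [Field F] (q : ℕ) (π : PGPoint F → PGLine F) : Prop :=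
  ∃ A : Matrix (Fin 3) (Fin 3) F, A.det ≠ 0 ∧ (∀ i j, A j i = A i j ^ q) ∧
    ∀ (x : Fin 3 → F) (hx : x ≠ 0) (y : Fin 3 → F),
      y ∈ (π (Projectivization.mk F x hx)).1 ↔ y ⬝ᵥ (A *ᵥ fun i => x i ^ q) = 0

/-- A point is absolute if it lies on its image under the polarity. -/
def IsAbsolutePoint {F : Type*} [Field F] (π : PGPoint F → PGLine F) (p : PGPoint F) : Prop :=
  PGOn p (π p)

/-- A line is absolute if it is the image of a point that lies on it. -/
def IsAbsoluteLine {F : Type*} [Field F] (π : PGPoint F → PGLine F) (L : PGLine F) : Prop :=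
  ∃ p : PGPoint F, π p = L ∧ PGOn p L

/-- The points of the classical unital of `π`: the absolute points. -/
abbrev ClassicalUnitalPoint {F : Type*} [Field F] (π : PGPoint F → PGLine F) : Type _ :=
  {p : PGPoint F // IsAbsolutePoint π p}

/-- The blocks of the classical unital of `π`: the sets of absolute points on the
non-absolute lines. -/
def classicalUnitalBlocks {F : Type*} [Field F] (π : PGPoint F → PGLine F) :
    Set (Set (ClassicalUnitalPoint π)) :=
  {B | ∃ L : PGLine F, ¬ IsAbsoluteLine π L ∧ B = {p | PGOn p.1 L}}

/-- `c(n) = n² - (√(8n² + 9) - 3) / 2`. -/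
noncomputable def unitalC (n : ℕ) : ℝ :=
  (n : ℝ) ^ 2 - (Real.sqrt (8 * (n : ℝ) ^ 2 + 9) - 3) / 2

/-! The unital is a 2-(q³+1, q+1, 1) design with q² blocks on each point, so the graph has
q²(q²+1)+1 vertices and `S` has at most M = q²(q²+1)/2. Write t = ⌊c(q)⌋ = q² - D and K = q³+1-t;
the claim is that the minimum ratio is K/M.

Upper bound: an arc of t points (no three on a block) meets exactly t(2q²+1-t)/2 blocks, and 2q² ≤
D²+3D says that the arc and these blocks together have at most M elements. Adding further blocks up
to size M leaves only the q³+1-t points off the arc as neighbours. Such an arc exists: identify F³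
with the field L of order q⁶, with form Tr(y x^(q³)). If x₀ ≠ 0 is isotropic, the vectors x₀u with
u^(q³+1) = 1 are isotropic and give at least q²-q+1 ≥ t points. A dependence among three such u
makes a ratio of two of them quadratic over F; it then lies in F because [L:F] = 3
(`exists_ratio_mem_of_dependent`).

Lower bound: let `X`, `Y` be the points and blocks of `S`, and `Z` the points outside `S ∪ N(S)`.
Every block meeting both `X` and `Z` is in `N(S)`, and no block of `Y` meets `Z`. Three counts, by
Bonferroni, Cauchy–Schwarz and AM–GM on block traces, bound the blocks meeting `X`, meeting `Z`, and
meeting both. `expansion_inequality` combines them: either |N(S)| ≥ K, or `Z` is so large that the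
points and the blocks of `S` can be charged separately. -/

section BlockCounting

open Finset

/-! ### Counting blocks in a design with the parameters of a unital. -/

section Design

set_option linter.unusedSectionVars false

variable {P β : Type*} [Fintype P] [Fintype β] [DecidableEq P] [DecidableEq β]
  {I : P → β → Prop} [∀ p B, Decidable (I p B)] {q : ℕ}

/-- The points of `X` on the block `B`. -/
def blockTrace (I : P → β → Prop) [∀ p B, Decidable (I p B)] (X : Finset P) (B : β) : Finset P :=
  X.filter (I · B)

/-- The blocks that meet `X`. -/
def meeting (I : P → β → Prop) [∀ p B, Decidable (I p B)] (X : Finset P) : Finset β :=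
  univ.filter fun B => (blockTrace I X B).Nonempty

theorem mem_meeting {X : Finset P} {B : β} : B ∈ meeting I X ↔ ∃ p ∈ X, I p B := by
  simp [meeting, blockTrace, Finset.Nonempty, mem_filter]

theorem sum_card_trace (hr : ∀ p, #{B | I p B} = q ^ 2) (X : Finset P) :
    ∑ B, #(blockTrace I X B) = q ^ 2 * #X := by
  simp only [blockTrace, card_filter]
  rw [sum_comm]
  simp only [← card_filter, hr, sum_const, smul_eq_mul, mul_comm]

theorem sum_card_trace_mul (hl : ∀ p p', p ≠ p' → #{B | I p B ∧ I p' B} = 1)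
    {X Z : Finset P} (hXZ : Disjoint X Z) :
    ∑ B, #(blockTrace I X B) * #(blockTrace I Z B) = #X * #Z := by
  have : ∀ B, #(blockTrace I X B) * #(blockTrace I Z B)
      = ∑ p ∈ X, ∑ p' ∈ Z, if I p B ∧ I p' B then 1 else 0 := by
    intro B
    simp only [blockTrace, card_filter, sum_mul_sum, ite_and, mul_ite, mul_one, mul_zero]
    refine sum_congr rfl fun p _ => sum_congr rfl fun p' _ => ?_
    split_ifs <;> rfl
  simp only [this]
  rw [sum_comm, card_eq_sum_ones, sum_mul]
  refine sum_congr rfl fun p hp => ?_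
  rw [sum_comm, one_mul, card_eq_sum_ones]
  refine sum_congr rfl fun p' hp' => ?_
  rw [← card_filter, hl p p']
  rintro rfl
  exact disjoint_left.1 hXZ hp hp'

theorem sum_card_trace_sq (hr : ∀ p, #{B | I p B} = q ^ 2)
    (hl : ∀ p p', p ≠ p' → #{B | I p B ∧ I p' B} = 1) (X : Finset P) :
    ∑ B, #(blockTrace I X B) ^ 2 + #X = #X ^ 2 + q ^ 2 * #X := by
  have : ∀ B, #(blockTrace I X B) ^ 2
      = ∑ p ∈ X, ∑ p' ∈ X, if I p B ∧ I p' B then 1 else 0 := by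
    intro B
    simp only [blockTrace, card_filter, sq, sum_mul_sum, ite_and, mul_ite, mul_one, mul_zero]
    refine sum_congr rfl fun p _ => sum_congr rfl fun p' _ => ?_
    split_ifs <;> rfl
  simp only [this]
  rw [sum_comm]
  have hp : ∀ p ∈ X, (∑ B, ∑ p' ∈ X, if I p B ∧ I p' B then 1 else 0) + 1 = #X + q ^ 2 := by
    intro p hp
    rw [sum_comm, ← add_sum_erase X _ hp]
    simp only [and_self]
    rw [← card_filter, hr]
    have : ∀ p' ∈ X.erase p, (∑ B, if I p B ∧ I p' B then 1 else 0) = 1 := by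
      intro p' hp'
      rw [← card_filter, hl p p' (ne_of_mem_erase hp').symm]
    rw [sum_congr rfl this, ← card_eq_sum_ones, ← card_erase_add_one hp]
    ring
  calc _ = ∑ p ∈ X, ((∑ B, ∑ p' ∈ X, if I p B ∧ I p' B then 1 else 0) + 1) := by
        rw [sum_add_distrib, ← card_eq_sum_ones]
    _ = _ := by rw [sum_congr rfl hp, sum_const, smul_eq_mul]; ring

theorem sum_meeting {f : ℕ → ℤ} (hf : f 0 = 0) (X : Finset P) :
    ∑ B ∈ meeting I X, f #(blockTrace I X B) = ∑ B, f #(blockTrace I X B) := by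
  rw [meeting, sum_filter]
  refine sum_congr rfl fun B _ => ?_
  split_ifs with h
  · rfl
  · rw [not_nonempty_iff_eq_empty.1 h, card_empty, hf]

/-- The second Bonferroni inequality for the number of blocks that meet `X`. -/
theorem two_mul_card_meeting (hr : ∀ p, #{B | I p B} = q ^ 2)
    (hl : ∀ p p', p ≠ p' → #{B | I p B ∧ I p' B} = 1) (X : Finset P) :
    2 * (#(meeting I X) : ℤ) = #X * (2 * q ^ 2 + 1 - #X)
      + ∑ B ∈ meeting I X, ((#(blockTrace I X B) : ℤ) - 1) * (#(blockTrace I X B) - 2) := by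
  have h1 : ∑ B ∈ meeting I X, (#(blockTrace I X B) : ℤ) = q ^ 2 * #X := by
    rw [sum_meeting (f := fun n => (n : ℤ)) (by simp)]
    exact_mod_cast sum_card_trace hr X
  have h2 : ∑ B ∈ meeting I X, (#(blockTrace I X B) : ℤ) ^ 2 + #X = #X ^ 2 + q ^ 2 * #X := by
    rw [sum_meeting (f := fun n => (n : ℤ) ^ 2) (by simp)]
    exact_mod_cast sum_card_trace_sq hr hl X
  have h3 : ∑ B ∈ meeting I X, ((#(blockTrace I X B) : ℤ) - 1) * (#(blockTrace I X B) - 2)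
      = ∑ B ∈ meeting I X, (#(blockTrace I X B) : ℤ) ^ 2
        - 3 * ∑ B ∈ meeting I X, (#(blockTrace I X B) : ℤ) + 2 * #(meeting I X) := by
    rw [mul_sum, ← sum_sub_distrib, card_eq_sum_ones]
    push_cast
    rw [mul_sum, ← sum_add_distrib]
    exact sum_congr rfl fun B _ => by ring
  rw [h3, h1]
  linarith

/-- Bonferroni applied to a subset of size u. The freedom in u matters because u(2q²+1-u) decreases
once u exceeds q²+1. -/
theorem card_mul_le_two_mul_card_meeting (hr : ∀ p, #{B | I p B} = q ^ 2)
    (hl : ∀ p p', p ≠ p' → #{B | I p B ∧ I p' B} = 1) (X : Finset P) (u : ℤ)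
    (hu : 0 ≤ u) (huX : u ≤ #X) :
    u * (2 * q ^ 2 + 1 - u) ≤ 2 * #(meeting I X) := by
  lift u to ℕ using hu
  obtain ⟨T, hTX, rfl⟩ := exists_subset_card_eq (show u ≤ #X by exact_mod_cast huX)
  have hsub : meeting I T ⊆ meeting I X := by
    intro B hB
    obtain ⟨p, hp, hpB⟩ := mem_meeting.1 hB
    exact mem_meeting.2 ⟨p, hTX hp, hpB⟩
  have hle : (#(meeting I T) : ℤ) ≤ #(meeting I X) := by exact_mod_cast card_le_card hsub
  have hnn : 0 ≤ ∑ B ∈ meeting I T, ((#(blockTrace I T B) : ℤ) - 1) * (#(blockTrace I T B) - 2) := by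
    refine sum_nonneg fun B _ => ?_
    generalize #(blockTrace I T B) = n
    rcases Nat.lt_or_ge n 2 with h | h
    · interval_cases n <;> norm_num
    · have : (2 : ℤ) ≤ n := by exact_mod_cast h
      exact mul_nonneg (by linarith) (by linarith)
  linarith [two_mul_card_meeting hr hl T]

/-- A block meeting an arc has trace 1 or 2, so every error term (n-1)(n-2) vanishes and Bonferroni
is an equality. -/
theorem two_mul_card_meeting_arc (hr : ∀ p, #{B | I p B} = q ^ 2)
    (hl : ∀ p p', p ≠ p' → #{B | I p B ∧ I p' B} = 1) {X : Finset P}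
    (hX : ∀ B, #(blockTrace I X B) ≤ 2) :
    2 * (#(meeting I X) : ℤ) = #X * (2 * q ^ 2 + 1 - #X) := by
  rw [two_mul_card_meeting hr hl, sum_eq_zero, add_zero]
  intro B hB
  have h0 : 0 < #(blockTrace I X B) := card_pos.2 (mem_filter.1 hB).2
  have h2 := hX B
  interval_cases #(blockTrace I X B) <;> norm_num

/-- The Cauchy–Schwarz bound for the number of blocks that meet `X`. -/
theorem pow_four_mul_card_le (hr : ∀ p, #{B | I p B} = q ^ 2)
    (hl : ∀ p p', p ≠ p' → #{B | I p B ∧ I p' B} = 1) (X : Finset P) :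
    (q : ℤ) ^ 4 * #X ≤ #(meeting I X) * (#X + q ^ 2 - 1) := by
  rcases X.eq_empty_or_nonempty with rfl | hne
  · simp [meeting, blockTrace]
  have h1 : ∑ B ∈ meeting I X, (#(blockTrace I X B) : ℤ) = q ^ 2 * #X := by
    rw [sum_meeting (f := fun n => (n : ℤ)) (by simp)]
    exact_mod_cast sum_card_trace hr X
  have h2 : ∑ B ∈ meeting I X, (#(blockTrace I X B) : ℤ) ^ 2 + #X = #X ^ 2 + q ^ 2 * #X := by
    rw [sum_meeting (f := fun n => (n : ℤ) ^ 2) (by simp)]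
    exact_mod_cast sum_card_trace_sq hr hl X
  have h3 := sq_sum_le_card_mul_sum_sq (s := meeting I X) (f := fun B => (#(blockTrace I X B) : ℤ))
  rw [h1] at h3
  have hpos : (0 : ℤ) < #X := by exact_mod_cast card_pos.2 hne
  refine le_of_mul_le_mul_right ?_ hpos
  calc (q : ℤ) ^ 4 * #X * #X = (q ^ 2 * #X) ^ 2 := by ring
    _ ≤ _ := h3
    _ = #(meeting I X) * (#X ^ 2 + q ^ 2 * #X - #X) := by rw [← h2]; ring
    _ = _ := by ring

/-- Blocks that meet two disjoint sets of points. -/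
theorem four_mul_card_mul_card_le (hk : ∀ B, #{p | I p B} = q + 1)
    (hl : ∀ p p', p ≠ p' → #{B | I p B ∧ I p' B} = 1)
    {X Z : Finset P} (hXZ : Disjoint X Z) :
    4 * (#X * #Z) ≤ (q + 1) ^ 2 * #(meeting I X ∩ meeting I Z) := by
  have h1 : ∑ B, #(blockTrace I X B) * #(blockTrace I Z B)
      = ∑ B ∈ meeting I X ∩ meeting I Z, #(blockTrace I X B) * #(blockTrace I Z B) := by
    symm
    refine sum_subset (subset_univ _) fun B _ hB => ?_
    by_contra hne
    refine hB (mem_inter.2 ⟨?_, ?_⟩) <;> refine mem_filter.2 ⟨mem_univ _, card_pos.1 ?_⟩ <;>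
      exact Nat.pos_of_ne_zero fun h0 => hne (by simp [h0])
  rw [← sum_card_trace_mul hl hXZ, h1, mul_sum]
  calc _ ≤ ∑ B ∈ meeting I X ∩ meeting I Z, (q + 1) ^ 2 := by
        refine sum_le_sum fun B _ => ?_
        have hd : Disjoint (blockTrace I X B) (blockTrace I Z B) :=
          disjoint_filter_filter hXZ
        -- The two traces are disjoint parts of one block, so by AM–GM their product is at most
        -- ((q+1)/2)².
        have hle : #(blockTrace I X B) + #(blockTrace I Z B) ≤ q + 1 := by
          rw [← card_union_of_disjoint hd, ← hk B]
          refine card_le_card fun p hp => ?_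
          rcases mem_union.1 hp with h | h <;> exact mem_filter.2 ⟨mem_univ _, (mem_filter.1 h).2⟩
        calc 4 * (#(blockTrace I X B) * #(blockTrace I Z B))
            ≤ (#(blockTrace I X B) + #(blockTrace I Z B)) ^ 2 := by
              rw [← mul_assoc]; exact four_mul_le_pow_two_add _ _
          _ ≤ _ := by gcongr
    _ = _ := by rw [sum_const, smul_eq_mul, mul_comm]

theorem card_points [Nonempty P] (hk : ∀ B, #{p | I p B} = q + 1)
    (hr : ∀ p, #{B | I p B} = q ^ 2)
    (hl : ∀ p p', p ≠ p' → #{B | I p B ∧ I p' B} = 1) : Fintype.card P = q ^ 3 + 1 := by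
  obtain ⟨p⟩ := ‹Nonempty P›
  have h := sum_card_trace_mul hl (disjoint_compl_right (a := ({p} : Finset P)))
  have h1 : ∀ B, #(blockTrace I {p} B) * #(blockTrace I {p}ᶜ B) = if I p B then q else 0 := by
    intro B
    split_ifs with hB
    · have e1 : #(blockTrace I {p} B) = 1 := by
        rw [card_eq_one]
        exact ⟨p, by ext x; simp [blockTrace, mem_filter]; rintro rfl; exact hB⟩
      have e2 : #(blockTrace I {p}ᶜ B) = q := by
        have : blockTrace I {p}ᶜ B = ({p | I p B} : Finset P).erase p := by
          ext x; simp [blockTrace, mem_filter]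
        rw [this, card_erase_of_mem (by simpa using hB), hk]; rfl
      rw [e1, e2, one_mul]
    · have : blockTrace I {p} B = ∅ := by
        ext x; simp [blockTrace, mem_filter]; rintro rfl; exact hB
      rw [this, card_empty, zero_mul]
  simp only [h1] at h
  rw [← sum_filter, sum_const, hr, smul_eq_mul, card_singleton, one_mul, card_compl,
    card_singleton] at h
  have : 0 < Fintype.card P := Fintype.card_pos_iff.2 ⟨p⟩
  have e : q ^ 3 = q ^ 2 * q := by ring
  omega

theorem card_blocks [Nonempty P] (hk : ∀ B, #{p | I p B} = q + 1)
    (hr : ∀ p, #{B | I p B} = q ^ 2)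
    (hl : ∀ p p', p ≠ p' → #{B | I p B ∧ I p' B} = 1) :
    (Fintype.card β : ℤ) = q ^ 2 * (q ^ 2 - q + 1) := by
  have h := sum_card_trace hr univ
  rw [card_univ, card_points hk hr hl] at h
  simp only [blockTrace, hk, sum_const, card_univ, smul_eq_mul] at h
  have h' : (Fintype.card β : ℤ) * (q + 1) = q ^ 2 * (q ^ 3 + 1) := by exact_mod_cast h
  have : (q : ℤ) + 1 ≠ 0 := by positivity
  refine mul_right_cancel₀ this ?_
  rw [h']; ring

end Design

end BlockCounting

/-! ### Integer inequalities behind the lower bound. -/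

theorem sq_ceil_lt {q D : ℤ} (hq : 3 ≤ q) (h : D ^ 2 + D < 2 * q ^ 2 + 2) : 2 * D ≤ 3 * q - 1 := by
  by_contra! hc
  nlinarith

/-- D² + D is even, so the strict bound improves by two. -/
theorem sq_add_self_le {q D : ℤ} (h : D ^ 2 + D < 2 * q ^ 2 + 2) : D ^ 2 + D ≤ 2 * q ^ 2 := by
  obtain ⟨k, hk⟩ := Int.even_mul_succ_self D
  have : D ^ 2 + D = 2 * k := by linarith
  omega

theorem sub_one_le_of_two_mul_sq_le {q D : ℤ} (hq : 3 ≤ q) (hD : 0 ≤ D)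
    (h : 2 * q ^ 2 ≤ D ^ 2 + 3 * D) : q - 1 ≤ D := by
  by_contra! hc
  nlinarith

/-- Charges the blocks of `S` when `Z` is large: the Cauchy–Schwarz bound turns `hy` into y(z+q²-1)
≤ q²(q-1)(q³+1-z). -/
theorem blocks_avoiding_le {q D y z hZ : ℤ} (hq : 3 ≤ q)
    (hDq : 2 * D ≤ 3 * q - 1) (hK : 0 < q ^ 3 + 1 - (q ^ 2 - D))
    (hzv : z ≤ q ^ 3 + 1) (hzt : q ^ 2 - D + 1 ≤ z)
    (hy : y ≤ q ^ 2 * (q ^ 2 - q + 1) - hZ) (hZ' : q ^ 4 * z ≤ hZ * (z + q ^ 2 - 1)) :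
    2 * (q ^ 3 + 1 - (q ^ 2 - D)) * y ≤ q ^ 2 * (q ^ 2 + 1) * (q ^ 3 + 1 - z) := by
  have hp : 0 < z + q ^ 2 - 1 := by nlinarith
  have hy2 : y * (z + q ^ 2 - 1) ≤ q ^ 2 * (q - 1) * (q ^ 3 + 1 - z) := by
    have := mul_le_mul_of_nonneg_right hy hp.le
    linarith
  have e1 : 2 * (q ^ 3 + 1 - (q ^ 2 - D)) * (q - 1) ≤ (q ^ 2 + 1) * (z + q ^ 2 - 1) := by
    have : (q ^ 2 + 1) * (2 * q ^ 2 - D) ≤ (q ^ 2 + 1) * (z + q ^ 2 - 1) :=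
      mul_le_mul_of_nonneg_left (by linarith) (by positivity)
    have h3 : 0 ≤ 4 * q ^ 3 - 2 * q + 2 - D * (q ^ 2 + 2 * q - 1) := by
      have h4 : (2 * D) * (q ^ 2 + 2 * q - 1) ≤ (3 * q) * (q ^ 2 + 2 * q - 1) :=
        mul_le_mul_of_nonneg_right (by linarith) (by nlinarith)
      nlinarith [mul_nonneg (sub_nonneg.2 hq) (sq_nonneg q)]
    linarith
  refine le_of_mul_le_mul_right ?_ hp
  calc 2 * (q ^ 3 + 1 - (q ^ 2 - D)) * y * (z + q ^ 2 - 1)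
      = 2 * (q ^ 3 + 1 - (q ^ 2 - D)) * (y * (z + q ^ 2 - 1)) := by ring
    _ ≤ 2 * (q ^ 3 + 1 - (q ^ 2 - D)) * (q ^ 2 * (q - 1) * (q ^ 3 + 1 - z)) := by gcongr
    _ = (q ^ 2 * (q ^ 3 + 1 - z)) * (2 * (q ^ 3 + 1 - (q ^ 2 - D)) * (q - 1)) := by ring
    _ ≤ (q ^ 2 * (q ^ 3 + 1 - z)) * ((q ^ 2 + 1) * (z + q ^ 2 - 1)) :=
        mul_le_mul_of_nonneg_left e1 (mul_nonneg (sq_nonneg q) (by linarith))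
    _ = _ := by ring

/-- Charges the points of `S` when `Z` is large: `hm'` gives m - x ≥ x(4z-(q+1)²)/(q+1)², and z > t
makes this factor big enough. -/
theorem points_le {q D x z m : ℤ} (hq : 3 ≤ q)
    (hDq : 2 * D ≤ 3 * q - 1) (hqD : q - 1 ≤ D) (h1 : 2 * q ^ 2 ≤ D ^ 2 + 3 * D)
    (h2 : D ^ 2 + D < 2 * q ^ 2 + 2)
    (hx : 0 ≤ x) (hzt : q ^ 2 - D + 1 ≤ z) (hm' : 4 * (x * z) ≤ (q + 1) ^ 2 * m) :
    2 * (q ^ 3 + 1 - (q ^ 2 - D)) * x ≤ q ^ 2 * (q ^ 2 + 1) * (m - x) := by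
  have hk : 0 < (q + 1) ^ 2 := by positivity
  have e2 : 2 * (q ^ 3 + 1 - (q ^ 2 - D)) * (q + 1) ^ 2
      ≤ q ^ 2 * (q ^ 2 + 1) * (4 * z - (q + 1) ^ 2) := by
    -- The polynomial estimate `h5` is false at q = 3, where D = 3 is checked directly.
    rcases eq_or_lt_of_le hq with rfl | hq4
    · have : D = 3 := by
        have : D ≤ 4 := by omega
        interval_cases D <;> omega
      subst this
      linarith
    · have hKq : q ^ 3 + 1 - (q ^ 2 - D) ≤ q ^ 3 := by nlinarith
      have hz3 : 3 * q ^ 2 - 8 * q + 5 ≤ 4 * z - (q + 1) ^ 2 := by linarith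
      have h5 : 2 * q * (q + 1) ^ 2 ≤ (q ^ 2 + 1) * (3 * q ^ 2 - 8 * q + 5) := by
        obtain ⟨w, rfl⟩ : ∃ w, q = w + 4 := ⟨q - 4, by ring⟩
        have hw : 0 ≤ w := by linarith
        have : 0 ≤ w ^ 2 := by positivity
        have : 0 ≤ w ^ 3 := by positivity
        have : 0 ≤ w ^ 4 := by positivity
        linarith
      calc 2 * (q ^ 3 + 1 - (q ^ 2 - D)) * (q + 1) ^ 2 ≤ 2 * q ^ 3 * (q + 1) ^ 2 := by gcongr
        _ = q ^ 2 * (2 * q * (q + 1) ^ 2) := by ring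
        _ ≤ q ^ 2 * ((q ^ 2 + 1) * (3 * q ^ 2 - 8 * q + 5)) := by gcongr
        _ ≤ q ^ 2 * ((q ^ 2 + 1) * (4 * z - (q + 1) ^ 2)) := by gcongr
        _ = _ := by ring
  refine le_of_mul_le_mul_right ?_ hk
  calc 2 * (q ^ 3 + 1 - (q ^ 2 - D)) * x * (q + 1) ^ 2
      = (2 * (q ^ 3 + 1 - (q ^ 2 - D)) * (q + 1) ^ 2) * x := by ring
    _ ≤ (q ^ 2 * (q ^ 2 + 1) * (4 * z - (q + 1) ^ 2)) * x := by gcongr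
    _ = (q ^ 2 * (q ^ 2 + 1)) * (4 * (x * z) - (q + 1) ^ 2 * x) := by ring
    _ ≤ (q ^ 2 * (q ^ 2 + 1)) * ((q + 1) ^ 2 * m - (q + 1) ^ 2 * x) := by gcongr
    _ = _ := by ring

/-- When x > t and z is small but positive, `X` meets at least M - t + z blocks. The hypothesis
`hprod` forces x - t to grow with z. -/
theorem hits_large {q D x z hX : ℤ} (hq : 3 ≤ q) (hD : 0 ≤ D)
    (h1 : 2 * q ^ 2 ≤ D ^ 2 + 3 * D) (h2 : D ^ 2 + D < 2 * q ^ 2 + 2)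
    (hz : 1 ≤ z)
    (hXu : ∀ u, 0 ≤ u → u ≤ x → u * (2 * q ^ 2 + 1 - u) ≤ 2 * hX)
    (hz4 : 4 * z < (q + 1) ^ 2)
    (hprod : (q + 1) ^ 2 * (4 * (q ^ 2 - D) - (q + 1) ^ 2)
      < ((q + 1) ^ 2 - 4 * z) * (4 * x - (q + 1) ^ 2))
    (hx : q ^ 2 - D + 1 ≤ x) :
    q ^ 2 * (q ^ 2 + 1) - 2 * (q ^ 2 - D) + 2 * z ≤ 2 * hX := by
  have hDq := sq_ceil_lt hq h2
  have hqD := sub_one_le_of_two_mul_sq_le hq hD h1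
  -- The estimate `h3` below can fail for q = 3 and q = 4, so these are done numerically.
  rcases eq_or_lt_of_le hq with rfl | hq4
  · have : D = 3 := by
      have : D ≤ 4 := by omega
      interval_cases D <;> omega
    subst this
    have := hXu 7 (by norm_num) (by linarith)
    norm_num at *
    omega
  rcases eq_or_lt_of_le (show 4 ≤ q by omega) with rfl | hq5
  · have : D = 5 := by
      have : D ≤ 5 := by omega
      interval_cases D <;> omega
    subst this
    have h12 := hXu 12 (by norm_num) (by linarith)
    norm_num at *
    by_cases hz1 : z = 1
    · omega
    · have : 14 ≤ x := by
        have : 2 ≤ z := by omega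
        nlinarith
      have h14 := hXu 14 (by norm_num) this
      omega
  have hpar := sq_add_self_le h2
  -- With u = t+1+j the Bonferroni bound exceeds its value at j = 0 by j(2D-1-j), which is at least
  -- jD for j ≤ D-1.
  have key : ∀ j, 0 ≤ j → j ≤ D - 1 → q ^ 2 - D + 1 + j ≤ x → 2 * z ≤ j * D →
      q ^ 2 * (q ^ 2 + 1) - 2 * (q ^ 2 - D) + 2 * z ≤ 2 * hX := by
    intro j hj0 hj hjx hjz
    have := hXu (q ^ 2 - D + 1 + j) (by nlinarith) hjx
    linarith [mul_nonneg hj0 (show 0 ≤ D - 1 - j by linarith)]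
  by_cases hc : x ≤ q ^ 2
  · refine key (x - (q ^ 2 - D + 1)) (by linarith) (by linarith) (by linarith) ?_
    have hez : z < x - (q ^ 2 - D) := by
      have h3 : (q + 1) ^ 2 - 4 * z ≤ 4 * (q ^ 2 - D) - (q + 1) ^ 2 := by nlinarith
      have h4 : 0 < (q + 1) ^ 2 - 4 * z := by linarith
      by_contra! hcon
      nlinarith
    nlinarith
  -- Here u = q², which maximizes u(2q²+1-u) over the integers.
  · refine key (D - 1) (by linarith) le_rfl (by linarith) ?_
    nlinarith

/-- The letters stand for x = |X|, y = |Y|, z = |Z|, n = |N(S)|; `hX` and `hZ` count the blocks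
meeting `X` and `Z`, and m those meeting both. -/
theorem expansion_inequality {q D x y z m hX hZ n : ℤ} (hq : 3 ≤ q) (hD : 0 ≤ D)
    (h1 : 2 * q ^ 2 ≤ D ^ 2 + 3 * D) (h2 : D ^ 2 + D < 2 * q ^ 2 + 2)
    (hx : 0 ≤ x) (hz : 0 ≤ z) (hzv : z ≤ q ^ 3 + 1) (hm : 0 ≤ m)
    (hs : 2 * (x + y) ≤ q ^ 2 * (q ^ 2 + 1))
    (hn1 : q ^ 3 + 1 - x - z + m ≤ n) (hn2 : q ^ 3 + 1 - x - z + hX - y ≤ n)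
    (hy : y ≤ q ^ 2 * (q ^ 2 - q + 1) - hZ)
    (hXu : ∀ u, 0 ≤ u → u ≤ x → u * (2 * q ^ 2 + 1 - u) ≤ 2 * hX)
    (hZ' : q ^ 4 * z ≤ hZ * (z + q ^ 2 - 1))
    (hm' : 4 * (x * z) ≤ (q + 1) ^ 2 * m) :
    2 * (q ^ 3 + 1 - (q ^ 2 - D)) * (x + y) ≤ q ^ 2 * (q ^ 2 + 1) * n := by
  have hDq := sq_ceil_lt hq h2
  have hqD := sub_one_le_of_two_mul_sq_le hq hD h1
  have hK : 0 < q ^ 3 + 1 - (q ^ 2 - D) := by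
    nlinarith only [mul_nonneg (sub_nonneg.2 hq) (sq_nonneg q), sq_nonneg q, hD]
  have hM : 0 < q ^ 2 * (q ^ 2 + 1) := by positivity
  have large : q ^ 3 + 1 - (q ^ 2 - D) ≤ n →
      2 * (q ^ 3 + 1 - (q ^ 2 - D)) * (x + y) ≤ q ^ 2 * (q ^ 2 + 1) * n := by
    intro h
    calc 2 * (q ^ 3 + 1 - (q ^ 2 - D)) * (x + y)
        = (q ^ 3 + 1 - (q ^ 2 - D)) * (2 * (x + y)) := by ring
      _ ≤ (q ^ 3 + 1 - (q ^ 2 - D)) * (q ^ 2 * (q ^ 2 + 1)) := by gcongr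
      _ = q ^ 2 * (q ^ 2 + 1) * (q ^ 3 + 1 - (q ^ 2 - D)) := by ring
      _ ≤ _ := by gcongr
  -- If `X` meets at least M - t + z blocks, then `hn2` gives n ≥ K + (M - |S|).
  have hits : q ^ 2 * (q ^ 2 + 1) - 2 * (q ^ 2 - D) + 2 * z ≤ 2 * hX →
      2 * (q ^ 3 + 1 - (q ^ 2 - D)) * (x + y) ≤ q ^ 2 * (q ^ 2 + 1) * n := by
    intro h
    generalize q ^ 2 * (q ^ 2 + 1) = M at *
    generalize hKK : q ^ 3 + 1 - (q ^ 2 - D) = K at *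
    have hn3 : 2 * K + M - 2 * (x + y) ≤ 2 * n := by linarith
    linarith [mul_le_mul_of_nonneg_left hn3 hM.le,
      mul_nonneg (show 0 ≤ M + 2 * K by linarith) (sub_nonneg.2 hs)]
  have h4t : (q + 1) ^ 2 ≤ 4 * (q ^ 2 - D) := by nlinarith only [hq, hDq]
  rcases eq_or_lt_of_le hz with rfl | hz1
  · by_cases hxt : x ≤ q ^ 2 - D
    · exact large (by linarith)
    · apply hits
      have := hXu (q ^ 2 - D + 1) (by linarith [sq_nonneg (q + 1)]) (by omega)
      linarith [sq_add_self_le h2]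
  -- After multiplication by 4(q+1)², this is the condition 4xz/(q+1)² ≥ x+z-t, which yields n ≥ K.
  -- If it fails, 4x-k and 4z-k have opposite signs, where k = (q+1)², and the positive one comes
  -- from a variable exceeding t.
  by_cases hprod : 0 ≤ (4 * x - (q + 1) ^ 2) * (4 * z - (q + 1) ^ 2)
      + (q + 1) ^ 2 * (4 * (q ^ 2 - D) - (q + 1) ^ 2)
  · apply large
    have hk : 0 < (q + 1) ^ 2 := by positivity
    have : (q + 1) ^ 2 * (x + z - (q ^ 2 - D)) ≤ (q + 1) ^ 2 * m := by linarith
    have := le_of_mul_le_mul_left this hk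
    linarith
  push Not at hprod
  have hk : 0 < (q + 1) ^ 2 := by positivity
  generalize hkk : (q + 1) ^ 2 = k at *
  have hk0 : 0 ≤ k * (4 * (q ^ 2 - D) - k) := mul_nonneg hk.le (by linarith)
  rcases lt_or_ge (4 * z) k with hzk | hzk
  · have hxk : 0 < 4 * x - k := by
      by_contra! hc
      linarith [mul_nonneg_of_nonpos_of_nonpos hc (show 4 * z - k ≤ 0 by linarith)]
    have hxt : q ^ 2 - D + 1 ≤ x := by
      by_contra! hc
      have : 4 * x - k ≤ 4 * (q ^ 2 - D) - k := by linarith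
      have : (k - 4 * z) * (4 * x - k) ≤ k * (4 * (q ^ 2 - D) - k) :=
        mul_le_mul (by linarith) this hxk.le hk.le
      linarith
    apply hits
    subst hkk
    exact hits_large hq hD h1 h2 hz1 hXu hzk (by linarith) hxt
  · have hxk : 0 < k - 4 * x := by
      by_contra! hc
      linarith [mul_nonneg (show 0 ≤ 4 * x - k by linarith) (show 0 ≤ 4 * z - k by linarith)]
    have hzt : q ^ 2 - D + 1 ≤ z := by
      by_contra! hc
      have : 4 * z - k ≤ 4 * (q ^ 2 - D) - k := by linarith
      have : (k - 4 * x) * (4 * z - k) ≤ k * (4 * (q ^ 2 - D) - k) :=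
        mul_le_mul (by linarith) this (by linarith) hk.le
      linarith
    subst hkk
    have ey := blocks_avoiding_le hq hDq hK hzv hzt hy hZ'
    have ex := points_le hq hDq hqD h1 h2 hx hzt hm'
    calc 2 * (q ^ 3 + 1 - (q ^ 2 - D)) * (x + y)
        = 2 * (q ^ 3 + 1 - (q ^ 2 - D)) * x + 2 * (q ^ 3 + 1 - (q ^ 2 - D)) * y := by ring
      _ ≤ q ^ 2 * (q ^ 2 + 1) * (m - x) + q ^ 2 * (q ^ 2 + 1) * (q ^ 3 + 1 - z) := by gcongr
      _ = q ^ 2 * (q ^ 2 + 1) * (q ^ 3 + 1 - x - z + m) := by ring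
      _ ≤ _ := by gcongr

/-! ### From block counts to the isoperimetric number. -/

section Isoperimetry

open Finset

/-- D is the ceiling of (√(8q²+9)-3)/2. Squaring the two inequalities that define a ceiling gives
the two quadratic bounds. -/
theorem exists_floor_unitalC (q : ℕ) :
    ∃ D : ℤ, ⌊unitalC q⌋ = (q : ℤ) ^ 2 - D ∧ 0 ≤ D ∧ 2 * (q : ℤ) ^ 2 ≤ D ^ 2 + 3 * D ∧
      D ^ 2 + D < 2 * (q : ℤ) ^ 2 + 2 := by
  refine ⟨(q : ℤ) ^ 2 - ⌊unitalC q⌋, by ring, ?_⟩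
  have h1 := Int.floor_le (unitalC q)
  have h2 := Int.lt_floor_add_one (unitalC q)
  generalize hD : (q : ℤ) ^ 2 - ⌊unitalC q⌋ = D
  have hf : (⌊unitalC q⌋ : ℝ) = (q : ℝ) ^ 2 - D := by rw [← hD]; push_cast; ring
  rw [hf, unitalC] at h1 h2
  set r := Real.sqrt (8 * (q : ℝ) ^ 2 + 9) with hr
  have hr2 : r ^ 2 = 8 * (q : ℝ) ^ 2 + 9 := Real.sq_sqrt (by positivity)
  have hr3 : 3 ≤ r := Real.le_sqrt_of_sq_le (by nlinarith [sq_nonneg (q : ℝ)])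
  have h0 : 0 ≤ (D : ℝ) := by linarith
  refine ⟨by exact_mod_cast h0, ?_, ?_⟩
  · have : 2 * (q : ℝ) ^ 2 ≤ D ^ 2 + 3 * D := by nlinarith
    exact_mod_cast this
  · have : (D : ℝ) ^ 2 + D < 2 * (q : ℝ) ^ 2 + 2 := by nlinarith
    exact_mod_cast this

section

set_option linter.unusedSectionVars false

variable {P : Type*} [Fintype P] [DecidableEq P] {𝓑 : Set (Set P)}

open Classical in
/-- The neighbourhood of a finite set of vertices, as a finset. -/
noncomputable def neighbourFinset [Fintype 𝓑] (s : Finset (P ⊕ 𝓑)) : Finset (P ⊕ 𝓑) :=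
  univ.filter (· ∈ vertexNeighbourhood (incidenceGraph 𝓑) ↑s)

theorem ncard_vertexNeighbourhood [Fintype 𝓑] (s : Finset (P ⊕ 𝓑)) :
    (vertexNeighbourhood (incidenceGraph 𝓑) (s : Set (P ⊕ 𝓑))).ncard = #(neighbourFinset s) := by
  rw [← Set.ncard_coe_finset]
  congr 1
  ext v
  simp [neighbourFinset]

theorem inl_mem_neighbourFinset [Fintype 𝓑] {s : Finset (P ⊕ 𝓑)} {p : P} :
    Sum.inl p ∈ neighbourFinset s ↔ Sum.inl p ∉ s ∧ ∃ B : 𝓑, Sum.inr B ∈ s ∧ p ∈ B.1 := by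
  classical
  rw [neighbourFinset, mem_filter, and_iff_right (mem_univ _), vertexNeighbourhood,
    Set.mem_ofPred_eq]
  simp only [mem_coe]
  refine and_congr_right fun _ => ⟨?_, ?_⟩
  · rintro ⟨p' | B, hu, h⟩
    · exact h.elim
    · exact ⟨B, hu, h⟩
  · rintro ⟨B, hu, h⟩
    exact ⟨Sum.inr B, hu, h⟩

theorem inr_mem_neighbourFinset [Fintype 𝓑] {s : Finset (P ⊕ 𝓑)} {B : 𝓑} :
    Sum.inr B ∈ neighbourFinset s ↔ Sum.inr B ∉ s ∧ ∃ p : P, Sum.inl p ∈ s ∧ p ∈ B.1 := by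
  classical
  rw [neighbourFinset, mem_filter, and_iff_right (mem_univ _), vertexNeighbourhood,
    Set.mem_ofPred_eq]
  simp only [mem_coe]
  refine and_congr_right fun _ => ⟨?_, ?_⟩
  · rintro ⟨p' | B, hu, h⟩
    · exact ⟨p', hu, h⟩
    · exact h.elim
  · rintro ⟨B, hu, h⟩
    exact ⟨Sum.inl B, hu, h⟩

variable [Fintype 𝓑] [DecidableEq 𝓑] [∀ (p : P) (B : 𝓑), Decidable (p ∈ B.1)] [Nonempty P] {q : ℕ}

theorem expansion_lower_bound (hq : 3 ≤ q)
    (hk : ∀ B : 𝓑, #{p | p ∈ B.1} = q + 1) (hr : ∀ p, #{B : 𝓑 | p ∈ B.1} = q ^ 2)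
    (hl : ∀ p p', p ≠ p' → #{B : 𝓑 | p ∈ B.1 ∧ p' ∈ B.1} = 1)
    {D : ℤ} (hD : 0 ≤ D) (h1 : 2 * (q : ℤ) ^ 2 ≤ D ^ 2 + 3 * D)
    (h2 : D ^ 2 + D < 2 * (q : ℤ) ^ 2 + 2) (s : Finset (P ⊕ 𝓑))
    (hs : 2 * (#s : ℤ) ≤ q ^ 2 * (q ^ 2 + 1)) :
    2 * ((q : ℤ) ^ 3 + 1 - (q ^ 2 - D)) * #s ≤ q ^ 2 * (q ^ 2 + 1) * #(neighbourFinset s) := by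
  set I : P → 𝓑 → Prop := fun p B => p ∈ B.1 with hI
  set X := s.toLeft with hX
  set Y := s.toRight with hY
  set Z : Finset P := univ.filter fun p => p ∉ X ∧ ∀ B ∈ Y, p ∉ B.1 with hZ
  have hXZ : Disjoint X Z := by
    rw [disjoint_left]
    intro p hp hpZ
    exact (mem_filter.1 hpZ).2.1 hp
  have hs' : (#s : ℤ) = #X + #Y := by
    exact_mod_cast (card_toLeft_add_card_toRight (u := s)).symm
  have hv := card_points hk hr hl
  have hb := card_blocks hk hr hl
  have hNl : (neighbourFinset s).toLeft = (X ∪ Z)ᶜ := by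
    ext p
    simp only [mem_toLeft, inl_mem_neighbourFinset, mem_compl, mem_union, hX, hY, hZ, mem_filter,
      mem_univ, true_and, mem_toRight]
    push Not
    tauto
  have hNr : (neighbourFinset s).toRight = meeting I X \ Y := by
    ext B
    simp only [mem_toRight, inr_mem_neighbourFinset, mem_sdiff, mem_meeting, hX, hY, mem_toLeft, hI]
    tauto
  have hn : (#(neighbourFinset s) : ℤ) = q ^ 3 + 1 - #X - #Z + #(meeting I X \ Y) := by
    have e1 := card_toLeft_add_card_toRight (u := neighbourFinset s)
    have e2 := card_compl_add_card (X ∪ Z)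
    rw [card_union_of_disjoint hXZ, hv] at e2
    rw [hNl, hNr] at e1
    zify at e1 e2
    linarith
  have hzv : (#Z : ℤ) ≤ q ^ 3 + 1 := by
    exact_mod_cast hv ▸ card_le_univ Z
  have hYZ : Disjoint Y (meeting I Z) := by
    rw [disjoint_left]
    intro B hB hBZ
    obtain ⟨p, hp, hpB⟩ := mem_meeting.1 hBZ
    exact (mem_filter.1 hp).2.2 B hB hpB
  rw [hs']
  refine expansion_inequality (m := #(meeting I X ∩ meeting I Z)) (hX := #(meeting I X))
    (hZ := #(meeting I Z)) (by exact_mod_cast hq) hD h1 h2 (by positivity) (by positivity) hzv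
    (by positivity) (hs' ▸ hs) ?_ ?_ ?_ (card_mul_le_two_mul_card_meeting hr hl X)
    (pow_four_mul_card_le hr hl Z) ?_
  -- A block meeting `X` and `Z` cannot be in `Y`, since points of `Z` lie on no block of `Y`.
  · rw [hn]
    gcongr
    intro B hB
    rw [mem_inter] at hB
    exact mem_sdiff.2 ⟨hB.1, fun h => disjoint_left.1 hYZ h hB.2⟩
  · rw [hn]
    have := le_card_sdiff Y (meeting I X)
    have : (#(meeting I X) : ℤ) ≤ #(meeting I X \ Y) + #Y := by
      exact_mod_cast Nat.sub_le_iff_le_add.1 this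
    linarith
  · rw [← hb]
    have : #Y + #(meeting I Z) ≤ Fintype.card 𝓑 := by
      rw [← card_union_of_disjoint hYZ]
      exact card_le_univ _
    zify at this
    linarith
  · exact_mod_cast four_mul_card_mul_card_le hk hl hXZ

theorem exists_small_neighbourhood (hq : 3 ≤ q)
    (hk : ∀ B : 𝓑, #{p | p ∈ B.1} = q + 1) (hr : ∀ p, #{B : 𝓑 | p ∈ B.1} = q ^ 2)
    (hl : ∀ p p', p ≠ p' → #{B : 𝓑 | p ∈ B.1 ∧ p' ∈ B.1} = 1)
    {D : ℤ} (hD : 0 ≤ D) (h1 : 2 * (q : ℤ) ^ 2 ≤ D ^ 2 + 3 * D)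
    (h2 : D ^ 2 + D < 2 * (q : ℤ) ^ 2 + 2)
    (T : Finset P) (hT : (q : ℤ) ^ 2 - q + 1 ≤ #T)
    (harc : ∀ B : 𝓑, #{p ∈ T | p ∈ B.1} ≤ 2) :
    ∃ s : Finset (P ⊕ 𝓑), 2 * (#s : ℤ) = q ^ 2 * (q ^ 2 + 1) ∧
      (#(neighbourFinset s) : ℤ) ≤ q ^ 3 + 1 - (q ^ 2 - D) := by
  have hq' : (3 : ℤ) ≤ q := by exact_mod_cast hq
  have hDq := sq_ceil_lt hq' h2
  have hqD := sub_one_le_of_two_mul_sq_le hq' hD h1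
  set I : P → 𝓑 → Prop := fun p B => p ∈ B.1 with hI
  obtain ⟨t, ht⟩ := Int.eq_ofNat_of_zero_le (show 0 ≤ (q : ℤ) ^ 2 - D by nlinarith)
  obtain ⟨T', hT'T, hT'⟩ := exists_subset_card_eq (show t ≤ #T by zify; linarith)
  have harc' : ∀ B : 𝓑, #(blockTrace I T' B) ≤ 2 := fun B =>
    (card_le_card (filter_subset_filter _ hT'T)).trans (harc B)
  have hmeet := two_mul_card_meeting_arc hr hl harc'
  rw [hT', ← ht] at hmeet
  obtain ⟨M, hM⟩ : ∃ M : ℤ, (q : ℤ) ^ 2 * (q ^ 2 + 1) = 2 * M := by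
    obtain ⟨k, hk⟩ := Int.even_mul_succ_self ((q : ℤ) ^ 2)
    exact ⟨k, by linarith⟩
  -- The arc and the blocks meeting it fit into M vertices; this is 2q² ≤ D²+3D rewritten.
  have hMt : (#(meeting I T') : ℤ) ≤ M - t := by
    rw [← ht]
    linarith
  obtain ⟨y, hy⟩ := Int.eq_ofNat_of_zero_le (show 0 ≤ M - t by linarith [Int.natCast_nonneg #(meeting I T')])
  have hb := card_blocks hk hr hl
  obtain ⟨Y, hYsub, -, hY⟩ := exists_subsuperset_card_eq (n := y) (subset_univ (meeting I T'))
    (by zify; linarith) (by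
      rw [card_univ]; zify; rw [hb, ← hy, ← ht]
      nlinarith only [hM, mul_nonneg (sub_nonneg.2 hq') (sq_nonneg (q : ℤ)), hDq,
        mul_nonneg (mul_nonneg (sub_nonneg.2 hq') (sq_nonneg (q : ℤ))) (sub_nonneg.2 hq'),
        mul_nonneg (sub_nonneg.2 hq') (sub_nonneg.2 hq')])
  refine ⟨T'.disjSum Y, ?_, ?_⟩
  · rw [card_disjSum, hT', hY]
    push_cast
    linarith
  · have hsub : neighbourFinset (T'.disjSum Y) ⊆ T'ᶜ.disjSum ∅ := by
      rintro (p | B) h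
      · rw [inl_mem_neighbourFinset] at h
        simp only [inl_mem_disjSum] at h ⊢
        exact mem_compl.2 h.1
      · rw [inr_mem_neighbourFinset] at h
        simp only [inl_mem_disjSum, inr_mem_disjSum] at h
        obtain ⟨hB, p, hp, hpB⟩ := h
        exact (hB (hYsub (mem_meeting.2 ⟨p, hp, hpB⟩))).elim
    have hle := card_le_card hsub
    rw [card_disjSum, card_empty, add_zero] at hle
    have hv := card_points hk hr hl
    have e2 := card_compl_add_card T'
    rw [hv, hT'] at e2
    zify at hle e2
    linarith

end

/-- The vertex-isoperimetric number of the incidence graph of a unital of order `q` that contains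
a large arc. -/
theorem vertexIsoperimetricNumber_incidenceGraph {P : Type*} [Finite P] {𝓑 : Set (Set P)} {q : ℕ}
    (hq : 3 ≤ q) (hk : ∀ B ∈ 𝓑, B.ncard = q + 1) (hr : ∀ p, {B | B ∈ 𝓑 ∧ p ∈ B}.ncard = q ^ 2)
    (hl : ∀ p p', p ≠ p' → ∃! B, B ∈ 𝓑 ∧ p ∈ B ∧ p' ∈ B)
    (T : Set P) (hT : q ^ 2 + 1 ≤ T.ncard + q) (harc : ∀ B ∈ 𝓑, (B ∩ T).ncard ≤ 2) :
    vertexIsoperimetricNumber (incidenceGraph 𝓑) =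
      2 * ((q : ℝ) ^ 3 + 1 - (⌊unitalC q⌋ : ℝ)) / ((q : ℝ) ^ 2 * ((q : ℝ) ^ 2 + 1)) := by
  classical
  have := Fintype.ofFinite P
  have := Fintype.ofFinite 𝓑
  have hk' : ∀ B : 𝓑, #{p | p ∈ B.1} = q + 1 := by
    intro B
    rw [← hk B.1 B.2, ← Set.ncard_coe_finset]
    congr 1
    ext; simp
  have hr' : ∀ p, #{B : 𝓑 | p ∈ B.1} = q ^ 2 := by
    intro p
    rw [← hr p, ← card_map (Function.Embedding.subtype _), ← Set.ncard_coe_finset]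
    congr 1
    ext B
    simp [and_comm]
  have hl' : ∀ p p', p ≠ p' → #{B : 𝓑 | p ∈ B.1 ∧ p' ∈ B.1} = 1 := by
    intro p p' hne
    obtain ⟨B, ⟨hB, hpB⟩, huniq⟩ := hl p p' hne
    rw [card_eq_one]
    refine ⟨⟨B, hB⟩, ?_⟩
    ext C
    simp only [mem_filter, mem_univ, true_and, mem_singleton]
    exact ⟨fun h => Subtype.ext (huniq C ⟨C.2, h⟩), by rintro rfl; exact hpB⟩
  have : Nonempty P := by
    by_contra hP
    rw [not_nonempty_iff] at hP
    have : T.ncard = 0 := by rw [Set.eq_empty_of_isEmpty T, Set.ncard_empty]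
    nlinarith
  have hT' : (q : ℤ) ^ 2 - q + 1 ≤ #T.toFinset := by
    rw [← Set.ncard_eq_toFinset_card']
    zify at hT
    linarith
  have harc' : ∀ B : 𝓑, #{p ∈ T.toFinset | p ∈ B.1} ≤ 2 := by
    intro B
    refine le_trans (le_of_eq ?_) (harc B B.2)
    rw [← Set.ncard_coe_finset]
    congr 1
    ext; simp [and_comm]
  have hv := card_points hk' hr' hl'
  have hb := card_blocks hk' hr' hl'
  have hV : (Nat.card (P ⊕ 𝓑) : ℤ) = q ^ 2 * (q ^ 2 + 1) + 1 := by
    rw [Nat.card_eq_fintype_card, Fintype.card_sum, hv]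
    push_cast
    rw [hb]
    ring
  obtain ⟨D, hfl, hD, h1, h2⟩ := exists_floor_unitalC q
  have hfl' : (⌊unitalC q⌋ : ℝ) = (q : ℝ) ^ 2 - D := by rw [hfl]; push_cast; ring
  have hq0 : (0 : ℝ) < (q : ℝ) ^ 2 * ((q : ℝ) ^ 2 + 1) := by
    have : 0 < q := by omega
    positivity
  rw [hfl']
  have hVR : (Nat.card (P ⊕ 𝓑) : ℝ) = q ^ 2 * (q ^ 2 + 1) + 1 := by exact_mod_cast hV
  have hV2 : 2 ≤ Nat.card (P ⊕ 𝓑) := by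
    zify
    rw [hV]
    have : (0 : ℤ) < (q : ℤ) ^ 2 * ((q : ℤ) ^ 2 + 1) := by exact_mod_cast hq0
    linarith
  have hleast := isLeast_vertexIsoperimetricNumber (incidenceGraph 𝓑) hV2
  apply le_antisymm
  · obtain ⟨s, hs, hn⟩ := exists_small_neighbourhood hq hk' hr' hl' hD h1 h2 T.toFinset hT' harc'
    have hsR : 2 * (#s : ℝ) = q ^ 2 * (q ^ 2 + 1) := by exact_mod_cast hs
    have hnR : (#(neighbourFinset s) : ℝ) ≤ q ^ 3 + 1 - (q ^ 2 - D) := by exact_mod_cast hn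
    have hspos : (0 : ℝ) < #s := by linarith
    refine (hleast.2 ⟨(s : Set (P ⊕ 𝓑)), ?_, ?_, rfl⟩).trans ?_
    · exact_mod_cast card_pos.1 (by exact_mod_cast hspos)
    · rw [Set.ncard_coe_finset, hVR]
      linarith
    · rw [ncard_vertexNeighbourhood, Set.ncard_coe_finset, ← hsR,
        mul_div_mul_left _ _ (two_ne_zero' ℝ)]
      gcongr
  · obtain ⟨S, hne, hS, heq⟩ := hleast.1
    rw [heq]
    obtain ⟨s, rfl⟩ : ∃ s : Finset (P ⊕ 𝓑), S = s := ⟨S.toFinset, by simp⟩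
    rw [ncard_vertexNeighbourhood, Set.ncard_coe_finset]
    rw [Set.ncard_coe_finset, hVR] at hS
    have hspos : (0 : ℝ) < #s := by exact_mod_cast card_pos.2 (by exact_mod_cast hne)
    -- The number of vertices is odd, so the admissible size rounds down to M.
    have hs : 2 * (#s : ℤ) ≤ q ^ 2 * (q ^ 2 + 1) := by
      obtain ⟨k, hk⟩ := Int.even_mul_succ_self ((q : ℤ) ^ 2)
      have h : 2 * (#s : ℤ) ≤ q ^ 2 * (q ^ 2 + 1) + 1 := by
        have : 2 * (#s : ℝ) ≤ q ^ 2 * (q ^ 2 + 1) + 1 := by linarith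
        exact_mod_cast this
      rw [hk] at h ⊢
      omega
    have key := expansion_lower_bound hq hk' hr' hl' hD h1 h2 s hs
    have keyR : 2 * ((q : ℝ) ^ 3 + 1 - (q ^ 2 - D)) * #s
        ≤ q ^ 2 * (q ^ 2 + 1) * #(neighbourFinset s) := by exact_mod_cast key
    rw [div_le_div_iff₀ hq0 hspos]
    linarith

end Isoperimetry

/-! ### Finite fields and orthonormal bases of Hermitian spaces. -/

section HermitianForms

open Module

section FiniteFields

open Finset Polynomial

theorem pow_natCard_eq_self {K : Type*} [Field K] [Finite K] (x : K) : x ^ Nat.card K = x := by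
  have := Fintype.ofFinite K
  rw [Nat.card_eq_fintype_card, FiniteField.pow_card]

/-- The field of order `n²` has `n + 1` elements of each non-zero norm over its subfield of
order `n`. -/
theorem ncard_norm_fibre {K : Type*} [Field K] [Finite K] {n : ℕ} (hK : Nat.card K = n ^ 2)
    {s : K} (hs : s ≠ 0) (hsn : s ^ n = s) : {c : K | c ^ (n + 1) = s}.ncard = n + 1 := by
  classical
  have := Fintype.ofFinite K
  have hn : 2 ≤ n := by
    have h1 : 1 < Nat.card K := Finite.one_lt_card
    by_contra h
    have : n ≤ 1 := by omega
    interval_cases n <;> omega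
  obtain ⟨m, rfl⟩ : ∃ m, n = m + 1 := ⟨n - 1, by omega⟩
  have hm : 0 < m := by omega
  have hfix : ∀ x : K, x ≠ 0 → (x ^ (m + 1) = x ↔ x ^ m = 1) := by
    intro x hx
    rw [pow_succ]
    exact ⟨fun h => mul_right_cancel₀ hx (by rw [h, one_mul]), fun h => by rw [h, one_mul]⟩
  set S := (nthRoots m (1 : K)).toFinset with hS
  have hScard : #S ≤ m := (Multiset.toFinset_card_le _).trans (card_nthRoots _ _)
  have hmem : ∀ x : K, x ∈ S ↔ x ^ m = 1 := by
    intro x; rw [hS, Multiset.mem_toFinset, mem_nthRoots hm]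
  have hmaps : ∀ c ∈ (univ.erase (0 : K)), c ^ (m + 1 + 1) ∈ S := by
    intro c hc
    have hc0 := ne_of_mem_erase hc
    rw [hmem, ← hfix _ (pow_ne_zero _ hc0), ← pow_mul]
    have : (m + 1 + 1) * (m + 1) = (m + 1) ^ 2 + (m + 1) := by ring
    rw [this, pow_add, ← hK, pow_natCard_eq_self, ← pow_succ']
  have hfib : ∀ a ∈ S, #{c ∈ univ.erase (0 : K) | c ^ (m + 1 + 1) = a} ≤ m + 1 + 1 := by
    intro a _
    refine (card_le_card (t := (nthRoots (m + 1 + 1) a).toFinset) fun c hc => ?_).trans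
      ((Multiset.toFinset_card_le _).trans (card_nthRoots _ _))
    rw [Multiset.mem_toFinset, mem_nthRoots (by omega)]
    exact (mem_filter.1 hc).2
  have hsum := card_eq_sum_card_fiberwise hmaps
  rw [card_erase_of_mem (mem_univ _), card_univ, ← Nat.card_eq_fintype_card, hK] at hsum
  have heq : {c : K | c ^ (m + 1 + 1) = s}.ncard
      = #{c ∈ univ.erase (0 : K) | c ^ (m + 1 + 1) = s} := by
    rw [← Set.ncard_coe_finset]
    congr 1
    ext c
    simp only [Set.mem_ofPred_eq, coe_filter, mem_erase, mem_univ, and_true]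
    refine ⟨fun h => ⟨?_, h⟩, fun h => h.2⟩
    rintro rfl
    exact hs (by rw [← h, zero_pow (by omega)])
  rw [heq]
  have hsS : s ∈ S := (hmem s).2 ((hfix s hs).1 hsn)
  -- Pigeonhole: n²-1 non-zero elements fall into at most n-1 fibres of size at most n+1, so every
  -- fibre is full.
  refine le_antisymm (hfib s hsS) ?_
  by_contra! hlt
  have hlt' := sum_lt_sum hfib ⟨s, hsS, hlt⟩
  rw [← hsum, sum_const, smul_eq_mul] at hlt'
  have h1 : #S * (m + 1 + 1) ≤ m * (m + 1 + 1) := Nat.mul_le_mul_right _ hScard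
  have h2 : (m + 1) ^ 2 = m * (m + 1 + 1) + 1 := by ring
  omega

theorem exists_pow_succ_eq {K : Type*} [Field K] [Finite K] {n : ℕ} (hK : Nat.card K = n ^ 2)
    {s : K} (hs : s ≠ 0) (hsn : s ^ n = s) : ∃ c : K, c ^ (n + 1) = s := by
  have h : {c : K | c ^ (n + 1) = s}.Nonempty := by
    rw [← Set.ncard_pos, ncard_norm_fibre hK hs hsn]
    omega
  exact h

/-- X^n + X has degree n < n², so it cannot vanish on all of K. -/
theorem exists_add_pow_ne_zero {K : Type*} [Field K] [Finite K] {n : ℕ} (hn : 2 ≤ n)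
    (hK : Nat.card K = n ^ 2) : ∃ s : K, s + s ^ n ≠ 0 := by
  have := Fintype.ofFinite K
  by_contra! h
  have hdeg : (X ^ n + X : K[X]).natDegree = n := by
    rw [natDegree_add_eq_left_of_natDegree_lt] <;> simp
    omega
  have h0 : (X ^ n + X : K[X]) = 0 := by
    refine eq_zero_of_natDegree_lt_card_of_eval_eq_zero _ (f := id) Function.injective_id
      (fun s => ?_) ?_
    · simpa [add_comm] using h s
    · rw [hdeg, ← Nat.card_eq_fintype_card, hK]
      nlinarith
  rw [h0] at hdeg
  simp at hdeg
  omega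

theorem exists_ringHom_eq_pow {F K : Type*} [Field F] [Field K] [Finite F] [Algebra F K] {q : ℕ}
    (hq : IsPrimePow q) (hF : Nat.card F = q ^ 2) (m : ℕ) :
    ∃ τ : K →+* K, ∀ x, τ x = x ^ q ^ m := by
  obtain ⟨p, k, hp, hk, rfl⟩ := hq
  have := Fintype.ofFinite F
  obtain ⟨p', hp'⟩ := CharP.exists F
  obtain ⟨n, hp'p, hn⟩ := FiniteField.card F p'
  have : p' = p := by
    rw [← Nat.card_eq_fintype_card, hF, ← pow_mul] at hn
    refine ((Nat.prime_dvd_prime_iff_eq hp'p hp.nat_prime).1 (hp'p.dvd_of_dvd_pow (n := k * 2) ?_))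
    rw [hn]
    exact dvd_pow_self _ n.ne_zero
  subst this
  have : Fact p'.Prime := ⟨hp'p⟩
  have : CharP K p' := charP_of_injective_algebraMap (algebraMap F K).injective p'
  exact ⟨iterateFrobenius K p' (k * m), fun x => by rw [iterateFrobenius_def, pow_mul]⟩

/-- The degree of z over F divides 3 and is at most 2. -/
theorem mem_range_algebraMap_of_quadratic {F L : Type*} [Field F] [Field L] [Algebra F L]
    (hFL : finrank F L = 3) {z : L} {b c : F}
    (h : z ^ 2 + algebraMap F L b * z + algebraMap F L c = 0) : z ∈ (algebraMap F L).range := by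
  have : FiniteDimensional F L := FiniteDimensional.of_finrank_pos (by omega)
  have hint : IsIntegral F z := Algebra.IsIntegral.isIntegral z
  have hdvd := minpoly.degree_dvd hint
  rw [hFL] at hdvd
  have hmon : (X ^ 2 + C b * X + C c : F[X]).Monic := by monicity!
  have hdeg : (X ^ 2 + C b * X + C c : F[X]).natDegree = 2 := by compute_degree!
  have hle : (minpoly F z).natDegree ≤ 2 := by
    rw [← hdeg]
    exact natDegree_le_of_dvd (minpoly.dvd F z (by simpa using h)) hmon.ne_zero
  have hone : (minpoly F z).natDegree = 1 := by
    have := (Nat.dvd_prime Nat.prime_three).1 hdvd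
    omega
  exact minpoly.natDegree_eq_one_iff.1 hone

end FiniteFields

section Forms

variable {F : Type*} [Field F] {σ : F →+* F} {V : Type*} [AddCommGroup V] [Module F V]

/-- A non-degenerate Hermitian form with respect to `σ`. -/
structure IsHermitianForm (h : V →ₗ[F] V →ₛₗ[σ] F) : Prop where
  symm : ∀ x y, h y x = σ (h x y)
  nondegenerate : ∀ x, (∀ y, h x y = 0) → x = 0

variable {h : V →ₗ[F] V →ₛₗ[σ] F}

theorem IsHermitianForm.eq_zero_comm (hh : IsHermitianForm h) {x y : V} :
    h x y = 0 ↔ h y x = 0 := by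
  rw [hh.symm x y, map_eq_zero σ]

/-- The vectors `e i` are orthonormal. -/
def IsOrthonormalFamily {ι : Type*} [DecidableEq ι] (h : V →ₗ[F] V →ₛₗ[σ] F) (e : ι → V) : Prop :=
  ∀ i j, h (e i) (e j) = if i = j then 1 else 0

section

variable {ι : Type*} [DecidableEq ι] [Fintype ι] {e : ι → V}

theorem IsOrthonormalFamily.linearIndependent (he : IsOrthonormalFamily h e) :
    LinearIndependent F e := by
  rw [Fintype.linearIndependent_iff]
  intro g hg i
  have := congrArg (fun v => h v (e i)) hg
  simpa [he _ _] using this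

theorem IsOrthonormalFamily.sum_smul [FiniteDimensional F V] (he : IsOrthonormalFamily h e)
    (hc : Fintype.card ι = finrank F V) (x : V) : ∑ i, h x (e i) • e i = x := by
  have hx : x ∈ Submodule.span F (Set.range e) := by
    rw [he.linearIndependent.span_eq_top_of_card_eq_finrank' hc]
    trivial
  obtain ⟨c, rfl⟩ := (Submodule.mem_span_range_iff_exists_fun F).1 hx
  refine Finset.sum_congr rfl fun i _ => ?_
  congr 1
  simp [he _ _]

theorem IsOrthonormalFamily.apply_sum (he : IsOrthonormalFamily h e) (c d : ι → F) :
    h (∑ i, c i • e i) (∑ i, d i • e i) = ∑ i, c i * σ (d i) := by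
  simp [he _ _, mul_comm]

end

variable [Finite F] {q : ℕ}

/-- Non-isotropic vectors can be normalized. -/
theorem IsHermitianForm.exists_smul_norm_one (hh : IsHermitianForm h) (hσ : ∀ x, σ x = x ^ q)
    (hF : Nat.card F = q ^ 2) {v : V} (hv : h v v ≠ 0) : ∃ c : F, c ≠ 0 ∧ h (c • v) (c • v) = 1 := by
  obtain ⟨c, hc⟩ := exists_pow_succ_eq hF (s := (h v v)⁻¹) (inv_ne_zero hv)
    (by rw [← hσ, map_inv₀, ← hh.symm])
  refine ⟨c, ?_, ?_⟩
  · rintro rfl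
    rw [zero_pow (by omega)] at hc
    exact inv_ne_zero hv hc.symm
  · simp only [map_smul, LinearMap.smul_apply, LinearMap.map_smulₛₗ, smul_eq_mul, hσ]
    rw [← mul_assoc, ← pow_succ, hc, inv_mul_cancel₀ hv]

/-- If the orthogonal complement of the family had only isotropic vectors, polarization would make h
vanish on it, and a non-zero w there would be orthogonal to everything. -/
theorem IsOrthonormalFamily.exists_extend [FiniteDimensional F V] (hh : IsHermitianForm h)
    (hσ : ∀ x, σ x = x ^ q) (hF : Nat.card F = q ^ 2) (hq : 2 ≤ q)
    {ι : Type*} [DecidableEq ι] [Fintype ι] {e : ι → V} (he : IsOrthonormalFamily h e)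
    (hc : Fintype.card ι < finrank F V) : ∃ v, h v v = 1 ∧ ∀ i, h v (e i) = 0 := by
  obtain ⟨w, hw0, hw⟩ : ∃ w : V, w ≠ 0 ∧ ∀ i, h w (e i) = 0 := by
    let f : V →ₗ[F] ι → F := LinearMap.pi fun i => h.flip (e i)
    have := LinearMap.ker_ne_bot_of_finrank_lt (f := f) (by simpa using hc)
    obtain ⟨w, hw, hw0⟩ := (Submodule.ne_bot_iff _).1 this
    refine ⟨w, hw0, fun i => ?_⟩
    exact congrFun (LinearMap.mem_ker.1 hw) i
  suffices ∃ v, h v v ≠ 0 ∧ ∀ i, h v (e i) = 0 by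
    obtain ⟨v, hv, hve⟩ := this
    obtain ⟨c, -, hc1⟩ := hh.exists_smul_norm_one hσ hF hv
    exact ⟨c • v, hc1, fun i => by simp [hve i]⟩
  by_contra! hcon
  have hiso : ∀ v, (∀ i, h v (e i) = 0) → h v v = 0 := fun v hv => by
    by_contra h0
    obtain ⟨i, hi⟩ := hcon v h0
    exact hi (hv i)
  apply hw0
  apply hh.nondegenerate
  have horth : ∀ x, (∀ i, h x (e i) = 0) → h w x = 0 := by
    intro x hx
    by_contra hwx
    -- Scaling w makes the cross terms s + s^q, which is non-zero for this s.
    obtain ⟨s, hs⟩ := exists_add_pow_ne_zero hq hF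
    apply hs
    have h1 := hiso ((s / h w x) • w + x) fun i => by simp [hw i, hx i]
    simp only [map_add, LinearMap.add_apply, map_smul, LinearMap.smul_apply,
      LinearMap.map_smulₛₗ, smul_eq_mul, hiso w hw, hiso x hx, mul_zero, zero_add, add_zero] at h1
    rw [hh.symm w x, ← map_mul, div_mul_cancel₀ _ hwx, hσ] at h1
    rw [← h1]; ring
  intro y
  have := horth (y - ∑ i, h y (e i) • e i) fun i => by simp [he _ _]
  simpa [hw] using this

theorem exists_orthonormal_three [FiniteDimensional F V] (hh : IsHermitianForm h)
    (hσ : ∀ x, σ x = x ^ q) (hF : Nat.card F = q ^ 2) (hq : 2 ≤ q) (hV : finrank F V = 3)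
    {v₀ : V} (hv₀ : h v₀ v₀ = 1) : ∃ v₁ v₂, IsOrthonormalFamily h ![v₀, v₁, v₂] := by
  have h1 : IsOrthonormalFamily h ![v₀] := by
    intro i j
    fin_cases i; fin_cases j
    simpa using hv₀
  obtain ⟨v₁, hv₁, hv₁₀⟩ := h1.exists_extend hh hσ hF hq (by simp [hV])
  have h10 : h v₁ v₀ = 0 := hv₁₀ 0
  have h01 := hh.eq_zero_comm.1 h10
  have h2 : IsOrthonormalFamily h ![v₀, v₁] := by
    intro i j
    fin_cases i <;> fin_cases j <;> simp [hv₀, hv₁, h10, h01]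
  obtain ⟨v₂, hv₂, hv₂'⟩ := h2.exists_extend hh hσ hF hq (by simp [hV])
  have h20 : h v₂ v₀ = 0 := hv₂' 0
  have h02 := hh.eq_zero_comm.1 h20
  have h21 : h v₂ v₁ = 0 := hv₂' 1
  have h12 := hh.eq_zero_comm.1 h21
  refine ⟨v₁, v₂, fun i j => ?_⟩
  fin_cases i <;> fin_cases j <;> simp [hv₀, hv₁, hv₂, h10, h01, h20, h02, h21, h12]

theorem exists_orthonormal_basis [FiniteDimensional F V] (hh : IsHermitianForm h)
    (hσ : ∀ x, σ x = x ^ q) (hF : Nat.card F = q ^ 2) (hq : 2 ≤ q) (hV : finrank F V = 3) :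
    ∃ e : Fin 3 → V, IsOrthonormalFamily h e := by
  have h0 : IsOrthonormalFamily h (![] : Fin 0 → V) := fun i => i.elim0
  obtain ⟨v₀, hv₀, -⟩ := h0.exists_extend hh hσ hF hq (by simp [hV])
  obtain ⟨v₁, v₂, he⟩ := exists_orthonormal_three hh hσ hF hq hV hv₀
  exact ⟨_, he⟩

end Forms

end HermitianForms

/-! ### A large arc on the Hermitian curve from a cubic extension. -/

section Arcs

open Module
open scoped LinearAlgebra.Projectivization

section CubicExtension

set_option linter.unusedSectionVars false

variable {F L : Type*} [Field F] [Finite F] [Field L] [Finite L] [Algebra F L] {q : ℕ}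
  {σ : F →+* F} {τ : L →+* L}

/-- The Hermitian form `Tr (y * τ x)` on an extension field. -/
noncomputable def traceHermitianForm (σ : F →+* F) (τ : L →+* L)
    (hστ : ∀ d, τ (algebraMap F L d) = algebraMap F L (σ d)) : L →ₗ[F] L →ₛₗ[σ] F :=
  LinearMap.mk₂'ₛₗ (RingHom.id F) σ (fun y x => Algebra.trace F L (y * τ x))
    (fun y y' x => by rw [add_mul, map_add])
    (fun c y x => by rw [smul_mul_assoc, map_smul]; rfl)
    (fun y x x' => by rw [map_add, mul_add, map_add])
    (fun c y x => by
      rw [Algebra.smul_def, map_mul τ, hστ, mul_left_comm, ← Algebra.smul_def, map_smul])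

theorem traceHermitianForm_apply (hστ : ∀ d, τ (algebraMap F L d) = algebraMap F L (σ d))
    (y x : L) : traceHermitianForm σ τ hστ y x = Algebra.trace F L (y * τ x) := rfl

/-- The trace is a sum of Frobenius powers, which commute with τ; non-degeneracy is that of the
trace form, as τ is an involution. -/
theorem isHermitianForm_traceHermitianForm
    (hστ : ∀ d, τ (algebraMap F L d) = algebraMap F L (σ d)) (hττ : ∀ x, τ (τ x) = x) :
    IsHermitianForm (traceHermitianForm σ τ hστ) where
  symm x y := by
    apply (algebraMap F L).injective
    rw [← hστ, traceHermitianForm_apply, traceHermitianForm_apply,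
      FiniteField.algebraMap_trace_eq_sum_pow, FiniteField.algebraMap_trace_eq_sum_pow, map_sum]
    refine Finset.sum_congr rfl fun i _ => ?_
    rw [map_pow, map_mul, hττ, mul_comm]
  nondegenerate x hx := by
    refine (traceForm_nondegenerate F L).1 x fun y => ?_
    have := hx (τ y)
    rwa [traceHermitianForm_apply, hττ] at this

/-- The unit circle of the cubic extension is an arc. -/
theorem exists_ratio_mem_of_dependent (hFL : finrank F L = 3)
    (hστ : ∀ d, τ (algebraMap F L d) = algebraMap F L (σ d))
    {u : Fin 3 → L} (hu : ∀ i, u i * τ (u i) = 1) {c : Fin 3 → F} (hc : c ≠ 0)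
    (hsum : ∑ i, c i • u i = 0) : ∃ i j, i ≠ j ∧ ∃ d : F, u i = d • u j := by
  have hu0 : ∀ i, u i ≠ 0 := fun i h => by simpa [h] using hu i
  rw [Fin.sum_univ_three] at hsum
  by_cases h0 : c 0 = 0
  · rw [h0, zero_smul, zero_add] at hsum
    by_cases h1 : c 1 = 0
    · exfalso
      apply hc
      rw [h1, zero_smul, zero_add, smul_eq_zero_iff_left (hu0 2)] at hsum
      ext i; fin_cases i <;> simp [h0, h1, hsum]
    · refine ⟨1, 2, by decide, -(c 1)⁻¹ * c 2, ?_⟩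
      rw [mul_smul, neg_smul, ← smul_neg, ← eq_neg_of_add_eq_zero_left hsum, inv_smul_smul₀ h1]
  by_cases h1 : c 1 = 0
  · rw [h1, zero_smul, add_zero] at hsum
    refine ⟨0, 2, by decide, -(c 0)⁻¹ * c 2, ?_⟩
    rw [mul_smul, neg_smul, ← smul_neg, ← eq_neg_of_add_eq_zero_left hsum, inv_smul_smul₀ h0]
  refine ⟨1, 0, by decide, ?_⟩
  -- The dependence is normalized to α + β = 1 with α = b·u₁/u₀ and β = d·u₂/u₀.
  set b : F := -c 1 / c 0 with hb
  set d : F := -c 2 / c 0 with hd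
  have hb0 : b ≠ 0 := div_ne_zero (neg_ne_zero.2 h1) h0
  have hrel : algebraMap F L b * (u 1 / u 0) + algebraMap F L d * (u 2 / u 0) = 1 := by
    have h0' : algebraMap F L (c 0) ≠ 0 := by simpa using h0
    simp only [Algebra.smul_def] at hsum
    rw [hb, hd, map_div₀, map_div₀, map_neg, map_neg]
    field_simp [hu0 0]
    linear_combination -hsum
  have hnorm : ∀ (e : F) (i : Fin 3), algebraMap F L e * (u i / u 0)
      * τ (algebraMap F L e * (u i / u 0)) = algebraMap F L (e * σ e) := by
    intro e i
    rw [map_mul τ, map_div₀ τ, hστ, map_mul (algebraMap F L)]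
    have h0' := hu 0
    have hi' := hu i
    have ht : τ (u 0) ≠ 0 := (map_ne_zero τ).2 (hu0 0)
    have hu00 := hu0 0
    field_simp
    linear_combination (algebraMap F L e * algebraMap F L (σ e)) * (hi' - h0')
  have hα := hnorm b 1
  have hβ := hnorm d 2
  set α := algebraMap F L b * (u 1 / u 0) with hαdef
  have hβα : algebraMap F L d * (u 2 / u 0) = 1 - α := by rw [← hrel]; ring
  rw [hβα, map_sub, map_one] at hβ
  -- Both α·τα and (1-α)·τ(1-α) lie in F, hence so does α + τα, and α is a root of a quadratic over
  -- F.
  have hquad : α ^ 2 + algebraMap F L (d * σ d - b * σ b - 1) * α + algebraMap F L (b * σ b) = 0 := by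
    rw [map_sub, map_sub, map_one, ← hα, ← hβ]
    ring
  obtain ⟨a, ha⟩ := mem_range_algebraMap_of_quadratic hFL hquad
  refine ⟨b⁻¹ * a, ?_⟩
  have hb0' : algebraMap F L b ≠ 0 := by simpa using hb0
  rw [Algebra.smul_def, map_mul, ha, map_inv₀, hαdef]
  field_simp [hu0 0]

end CubicExtension

section Arc

set_option linter.unusedSectionVars false

variable {F : Type*} [Field F] [Finite F] {q : ℕ} {σ : F →+* F}
  {V : Type*} [AddCommGroup V] [Module F V] [FiniteDimensional F V] {h : V →ₗ[F] V →ₛₗ[σ] F}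

/-- Hermitian spaces with orthonormal bases of the same size are isometric. -/
theorem exists_isometry {W : Type*} [AddCommGroup W] [Module F W] [FiniteDimensional F W]
    {h' : W →ₗ[F] W →ₛₗ[σ] F} (hh' : IsHermitianForm h')
    {ι : Type*} [Fintype ι] [DecidableEq ι] {e : ι → V} {e' : ι → W}
    (he : IsOrthonormalFamily h e) (he' : IsOrthonormalFamily h' e')
    (hc : Fintype.card ι = finrank F W) :
    ∃ ψ : W →ₗ[F] V, Function.Injective ψ ∧ ∀ x y, h (ψ x) (ψ y) = h' x y := by
  let ψ : W →ₗ[F] V := ∑ i, (h'.flip (e' i)).smulRight (e i)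
  have hψ : ∀ x, ψ x = ∑ i, h' x (e' i) • e i := fun x => by simp [ψ]
  have hiso : ∀ x y, h (ψ x) (ψ y) = h' x y := by
    intro x y
    rw [hψ, hψ, he.apply_sum]
    conv_rhs => rw [← he'.sum_smul hc x, ← he'.sum_smul hc y, he'.apply_sum]
  refine ⟨ψ, (injective_iff_map_eq_zero ψ).2 fun x hx => hh'.nondegenerate x fun y => ?_, hiso⟩
  rw [← hiso, hx, map_zero, LinearMap.zero_apply]

/-- A Hermitian curve contains an arc of size at least `(q³ + 1) / (q + 1)`. -/
theorem exists_isotropic_arc (hh : IsHermitianForm h) (hσ : ∀ x, σ x = x ^ q)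
    (hq : IsPrimePow q) (hF : Nat.card F = q ^ 2) (hV : finrank F V = 3) :
    ∃ A : Set (ℙ F V), (∀ p ∈ A, h p.rep p.rep = 0) ∧ q ^ 3 + 1 ≤ (q + 1) * A.ncard ∧
      ∀ W : Submodule F V, finrank F W = 2 → {p | p ∈ A ∧ p.submodule ≤ W}.ncard ≤ 2 := by
  classical
  have hq2 : 2 ≤ q := hq.two_le
  have hVfin : Finite V := Module.finite_of_finite F
  obtain ⟨p, hp⟩ := CharP.exists F
  have : Fact p.Prime := ⟨CharP.char_is_prime F p⟩
  let L := FiniteField.Extension F p 3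
  have hFL : finrank F L = 3 := FiniteField.finrank_extension F p 3
  have hL : Nat.card L = (q ^ 3) ^ 2 := by
    rw [FiniteField.natCard_extension F p 3, hF]; ring
  obtain ⟨τ, hτ⟩ := exists_ringHom_eq_pow (K := L) hq hF 3
  have hττ : ∀ x, τ (τ x) = x := fun x => by
    rw [hτ, hτ, ← pow_mul, ← sq, ← hL, pow_natCard_eq_self]
  -- On F, x^(q²) = x, so x^(q³) = x^q.
  have hστ : ∀ d, τ (algebraMap F L d) = algebraMap F L (σ d) := fun d => by
    rw [hτ, hσ, ← map_pow]
    congr 1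
    have : q ^ 3 = q ^ 2 * q := by ring
    rw [this, pow_mul, ← hF, pow_natCard_eq_self]
  set h' := traceHermitianForm σ τ hστ with hh'def
  have hh' : IsHermitianForm h' := isHermitianForm_traceHermitianForm hστ hττ
  obtain ⟨e, he⟩ := exists_orthonormal_basis hh hσ hF hq2 hV
  obtain ⟨e', he'⟩ := exists_orthonormal_basis hh' hσ hF hq2 hFL
  obtain ⟨ψ, hψinj, hψ⟩ := exists_isometry hh' he he' (by rw [hFL, Fintype.card_fin])
  -- With c^(q+1) = -1, the vector e'₀ + c·e'₁ is isotropic.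
  obtain ⟨c, hc⟩ := exists_pow_succ_eq hF (s := (-1 : F)) (by simp) (by rw [← hσ]; simp)
  obtain ⟨x₀, hx₀, hx₀0⟩ : ∃ x₀ : L, h' x₀ x₀ = 0 ∧ x₀ ≠ 0 := by
    refine ⟨e' 0 + c • e' 1, ?_, fun h0 => ?_⟩
    · have : c * σ c = -1 := by rw [hσ, ← pow_succ', hc]
      simp [he' _ _, mul_comm, this]
    · have := congrArg (fun v => h' v (e' 0)) h0
      simp [he' _ _] at this
  have hunit : ∀ u : L, u ^ (q ^ 3 + 1) = 1 → u * τ u = 1 := fun u hu => by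
    rw [hτ, ← pow_succ', hu]
  let v : L → V := fun u => ψ (x₀ * u)
  have hv0 : ∀ u : L, u ≠ 0 → v u ≠ 0 := fun u hu h0 =>
    mul_ne_zero hx₀0 hu (hψinj (by rw [map_zero]; exact h0))
  have hvv : ∀ u : L, u * τ u = 1 → h (v u) (v u) = 0 := fun u hu => by
    have : x₀ * u * τ (x₀ * u) = x₀ * τ x₀ := by
      rw [map_mul, mul_mul_mul_comm, hu, mul_one]
    rw [hψ, traceHermitianForm_apply, this, ← traceHermitianForm_apply hστ]
    exact hx₀
  let U : Finset L := {u : L | u ^ (q ^ 3 + 1) = 1}.toFinite.toFinset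
  have hU : ∀ u : L, u ∈ U ↔ u ^ (q ^ 3 + 1) = 1 := fun u => by simp [U]
  have hUcard : U.card = q ^ 3 + 1 := by
    rw [← Set.ncard_eq_toFinset_card, ncard_norm_fibre hL one_ne_zero (one_pow _)]
  have hU0 : ∀ u ∈ U, u ≠ 0 := by
    rintro u hu rfl
    simpa using (hU 0).1 hu
  let P : U → ℙ F V := fun u => Projectivization.mk F (v u) (hv0 u (hU0 u u.2))
  have hPeq : ∀ u u' : U, P u = P u' → ∃ d : F, (u : L) = d • (u' : L) := by
    intro u u' huu
    obtain ⟨d, hd⟩ := (Projectivization.mk_eq_mk_iff' F _ _ _ _).1 huu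
    refine ⟨d, mul_left_cancel₀ hx₀0 (hψinj ?_)⟩
    rw [mul_smul_comm, map_smul]
    exact hd.symm
  refine ⟨Set.range P, ?_, ?_, ?_⟩
  · rintro _ ⟨u, rfl⟩
    obtain ⟨a, ha⟩ := Projectivization.exists_smul_eq_mk_rep F (v u) (hv0 u (hU0 u u.2))
    change h (Projectivization.mk F (v u) _).rep (Projectivization.mk F (v u) _).rep = 0
    rw [← ha]
    simp only [Units.smul_def, map_smul, LinearMap.smul_apply, LinearMap.map_smulₛₗ,
      hvv u (hunit u ((hU u).1 u.2)), smul_zero]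
  · have hfib := Finset.card_le_mul_card_image (f := P) (Finset.univ : Finset U) (q + 1) ?_
    · rw [Finset.card_univ, Fintype.card_coe, hUcard] at hfib
      refine hfib.trans (le_of_eq ?_)
      rw [← Set.ncard_coe_finset]
      simp
    · intro x hx
      obtain ⟨u', -, rfl⟩ := Finset.mem_image.1 hx
      have hN : {d : F | d ^ (q + 1) = 1}.ncard = q + 1 :=
        ncard_norm_fibre hF one_ne_zero (one_pow _)
      have hcard : (Finset.univ.filter fun u : U => P u = P u').card
          = (Subtype.val '' {u : U | P u = P u'} : Set L).ncard := by
        rw [Set.ncard_image_of_injective _ Subtype.val_injective, ← Set.ncard_coe_finset]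
        simp
      -- Elements giving the same point differ by a scalar of F, necessarily of norm 1, so each
      -- point arises from at most q+1 elements.
      have hsub : (Subtype.val '' {u : U | P u = P u'} : Set L)
          ⊆ (fun d : F => d • (u' : L)) '' {d | d ^ (q + 1) = 1} := by
        rintro _ ⟨u, hu, rfl⟩
        obtain ⟨d, hd⟩ := hPeq u u' hu
        refine ⟨d, ?_, hd.symm⟩
        have h1 := hunit u ((hU u).1 u.2)
        have h2 := hunit u' ((hU u').1 u'.2)
        rw [hd, Algebra.smul_def, map_mul, hστ, mul_mul_mul_comm, h2, mul_one, ← map_mul, hσ,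
          ← pow_succ'] at h1
        exact (algebraMap F L).injective (by rw [h1, map_one])
      rw [hcard, ← hN]
      exact (Set.ncard_le_ncard hsub (Set.toFinite _)).trans (Set.ncard_image_le (Set.toFinite _))
  · intro W hW
    by_contra! hlt
    obtain ⟨_, _, _, ⟨⟨u₀, rfl⟩, h₀⟩, ⟨⟨u₁, rfl⟩, h₁⟩, ⟨⟨u₂, rfl⟩, h₂⟩, h01, h02, h12⟩ :=
      (Set.two_lt_ncard_iff (Set.toFinite _)).1 hlt
    let w : Fin 3 → U := ![u₀, u₁, u₂]
    have hw : ∀ i, v (w i) ∈ W := by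
      intro i
      have hmem : (P (w i)).submodule ≤ W := by fin_cases i <;> assumption
      rw [Projectivization.submodule_mk] at hmem
      exact hmem (Submodule.mem_span_singleton_self _)
    have hdep : ¬ LinearIndependent F (fun i => (⟨v (w i), hw i⟩ : W)) := by
      intro hli
      have := hli.fintype_card_le_finrank
      rw [hW, Fintype.card_fin] at this
      omega
    rw [Fintype.not_linearIndependent_iff] at hdep
    obtain ⟨g, hg, i₀, hi₀⟩ := hdep
    have hsum : ∑ i, g i • ((w i : U) : L) = 0 := by
      refine mul_left_cancel₀ hx₀0 (hψinj ?_)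
      rw [Finset.mul_sum, mul_zero, map_zero, map_sum]
      have := congrArg Subtype.val hg
      rw [AddSubmonoidClass.coe_finsetSum] at this
      rw [← Submodule.coe_zero (p := W), ← this]
      refine Finset.sum_congr rfl fun i _ => ?_
      rw [mul_smul_comm, map_smul]
      rfl
    obtain ⟨i, j, hij, d, hd⟩ := exists_ratio_mem_of_dependent hFL hστ
      (u := fun i => ((w i : U) : L)) (fun i => hunit _ ((hU _).1 (w i).2))
      (fun h0 => hi₀ (congrFun h0 i₀)) hsum
    have hP : P (w i) = P (w j) := by
      refine (Projectivization.mk_eq_mk_iff' F _ _ _ _).2 ⟨d, ?_⟩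
      rw [hd]
      simp only [v]
      rw [mul_smul_comm, map_smul]
    revert hP
    fin_cases i <;> fin_cases j <;>
      first | exact absurd rfl hij | exact h01 | exact h02 | exact h12 | exact h01.symm
            | exact h02.symm | exact h12.symm

end Arc

end Arcs

/-! ### The classical unital as a design. -/

section Unitals

open Module
open scoped LinearAlgebra.Projectivization Matrix

section Plane

variable {F : Type*} [Field F]

theorem pgOn_iff_rep_mem {p : PGPoint F} {L : PGLine F} : PGOn p L ↔ p.rep ∈ L.1 := by
  rw [PGOn, Projectivization.submodule_eq, Submodule.span_singleton_le_iff_mem]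

/-- Two points lie on exactly one line. -/
theorem existsUnique_line {p r : PGPoint F} (hpr : p ≠ r) :
    ∃! L : PGLine F, PGOn p L ∧ PGOn r L := by
  have hli := (Projectivization.independent_pair_iff_ne p r).2 hpr
  rw [Projectivization.independent_iff] at hli
  have hrank := finrank_span_eq_card hli
  refine ⟨⟨_, hrank⟩, ⟨?_, ?_⟩, ?_⟩
  · exact pgOn_iff_rep_mem.2 (Submodule.subset_span ⟨0, rfl⟩)
  · exact pgOn_iff_rep_mem.2 (Submodule.subset_span ⟨1, rfl⟩)
  · rintro L ⟨hp, hr⟩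
    refine Subtype.ext (Submodule.eq_of_le_of_finrank_eq ?_ (hrank.trans L.2.symm)).symm
    rw [Submodule.span_le]
    rintro _ ⟨i, rfl⟩
    fin_cases i
    · exact pgOn_iff_rep_mem.1 hp
    · exact pgOn_iff_rep_mem.1 hr

theorem ncard_points_on_line [Finite F] (L : PGLine F) :
    {p : PGPoint F | PGOn p L}.ncard = Nat.card F + 1 := by
  rw [← Projectivization.card_of_finrank_two F L.1 L.2, ← Set.ncard_univ,
    ← Set.ncard_image_of_injective _
      (Projectivization.map_injective L.1.subtype L.1.subtype_injective), Set.image_univ]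
  congr 1
  ext p
  constructor
  · intro hp
    have hp' := pgOn_iff_rep_mem.1 hp
    refine ⟨Projectivization.mk F ⟨p.rep, hp'⟩ fun h => p.rep_nonzero (congrArg Subtype.val h), ?_⟩
    rw [Projectivization.map_mk]
    exact p.mk_rep
  · rintro ⟨x, rfl⟩
    induction x using Projectivization.ind with
    | h v hv =>
      rw [Projectivization.map_mk, Set.mem_ofPred_eq, PGOn, Projectivization.submodule_mk,
        Submodule.span_singleton_le_iff_mem]
      exact v.2

theorem exists_hermitianForm {q : ℕ} {σ : F →+* F} (hσ : ∀ x, σ x = x ^ q)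
    (hσσ : ∀ x, σ (σ x) = x) {π : PGPoint F → PGLine F} (hπ : IsUnitaryPolarity q π) :
    ∃ h : (Fin 3 → F) →ₗ[F] (Fin 3 → F) →ₛₗ[σ] F, IsHermitianForm h ∧
      ∀ (x : Fin 3 → F) (hx : x ≠ 0) (y : Fin 3 → F),
        y ∈ (π (Projectivization.mk F x hx)).1 ↔ h y x = 0 := by
  obtain ⟨A, hdet, hA, hπ⟩ := hπ
  let h : (Fin 3 → F) →ₗ[F] (Fin 3 → F) →ₛₗ[σ] F :=
    LinearMap.mk₂'ₛₗ (RingHom.id F) σ (fun y x => y ⬝ᵥ (A *ᵥ (σ ∘ x)))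
      (fun y y' x => add_dotProduct _ _ _)
      (fun c y x => smul_dotProduct _ _ _)
      (fun y x x' => by
        have : σ ∘ (x + x') = σ ∘ x + σ ∘ x' := by ext; simp
        rw [this, Matrix.mulVec_add, dotProduct_add])
      (fun c y x => by
        have : σ ∘ (c • x) = σ c • (σ ∘ x) := by ext; simp
        rw [this, Matrix.mulVec_smul, dotProduct_smul])
  have hdef : ∀ y x, h y x = y ⬝ᵥ (A *ᵥ (σ ∘ x)) := fun _ _ => rfl
  refine ⟨h, ⟨fun x y => ?_, fun x hx => ?_⟩, fun x hx y => ?_⟩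
  · simp only [hdef, dotProduct, Matrix.mulVec, map_sum, map_mul, Function.comp_apply,
      Finset.mul_sum]
    rw [Finset.sum_comm]
    refine Finset.sum_congr rfl fun i _ => Finset.sum_congr rfl fun j _ => ?_
    rw [hσσ, hσ (A i j), ← hA]
    ring
  · refine Matrix.eq_zero_of_vecMul_eq_zero hdet ?_
    ext j
    have := hx (Pi.single j 1)
    have hs : σ ∘ (Pi.single j 1 : Fin 3 → F) = Pi.single j 1 := by
      ext i
      by_cases hij : i = j
      · subst hij; simp
      · simp [hij]
    rw [hdef, hs, Matrix.dotProduct_mulVec, dotProduct_single, mul_one] at this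
    exact this
  · rw [hπ, hdef]
    have : (fun i => x i ^ q) = σ ∘ x := by ext i; simp [hσ]
    rw [this]

end Plane

section Polarity

variable {F : Type*} [Field F] {q : ℕ} {σ : F →+* F}
  {h : (Fin 3 → F) →ₗ[F] (Fin 3 → F) →ₛₗ[σ] F} {π : PGPoint F → PGLine F}

theorem pgOn_polarity_iff
    (hπ : ∀ (x : Fin 3 → F) (hx : x ≠ 0) (y : Fin 3 → F),
      y ∈ (π (Projectivization.mk F x hx)).1 ↔ h y x = 0) {p r : PGPoint F} :
    PGOn p (π r) ↔ h p.rep r.rep = 0 := by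
  rw [pgOn_iff_rep_mem, ← hπ _ r.rep_nonzero, Projectivization.mk_rep]

variable (hh : IsHermitianForm h)
  (hπ : ∀ (x : Fin 3 → F) (hx : x ≠ 0) (y : Fin 3 → F),
      y ∈ (π (Projectivization.mk F x hx)).1 ↔ h y x = 0)

include hh hπ

theorem pgOn_polarity_comm {p r : PGPoint F} : PGOn p (π r) ↔ PGOn r (π p) := by
  rw [pgOn_polarity_iff hπ, pgOn_polarity_iff hπ, hh.eq_zero_comm]

theorem polarity_surjective : Function.Surjective π := by
  intro L
  let b := finBasisOfFinrankEq F L.1 L.2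
  let f : (Fin 3 → F) →ₗ[F] Fin 2 → F := LinearMap.pi fun i => h.flip (b i : Fin 3 → F)
  have hker := LinearMap.ker_ne_bot_of_finrank_lt (f := f) (by simp)
  obtain ⟨w, hw, hw0⟩ := (Submodule.ne_bot_iff _).1 hker
  have hwb : ∀ i, h (b i : Fin 3 → F) w = 0 := fun i =>
    hh.eq_zero_comm.1 (congrFun (LinearMap.mem_ker.1 hw) i)
  refine ⟨Projectivization.mk F w hw0, Subtype.ext (Submodule.eq_of_le_of_finrank_eq ?_ ?_).symm⟩
  · intro y hy
    rw [hπ]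
    have hrepr := congrArg Subtype.val (b.sum_repr ⟨y, hy⟩)
    rw [AddSubmonoidClass.coe_finsetSum] at hrepr
    simp only at hrepr
    rw [← hrepr]
    simp [hwb]
  · rw [L.2, (π _).2]

/-- Functionals with the same kernel are proportional, and non-degeneracy carries the
proportionality back to the representatives. -/
theorem polarity_injective (hσσ : ∀ x, σ (σ x) = x) : Function.Injective π := by
  intro p r hpr
  have hzero : ∀ y, h y p.rep = 0 ↔ h y r.rep = 0 := by
    intro y
    rw [← hπ _ p.rep_nonzero, ← hπ _ r.rep_nonzero, Projectivization.mk_rep,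
      Projectivization.mk_rep, hpr]
  obtain ⟨w, hw⟩ : ∃ w, h w p.rep ≠ 0 := by
    by_contra! hcon
    exact p.rep_nonzero (hh.nondegenerate _ fun y => hh.eq_zero_comm.1 (hcon y))
  have hwr : h w r.rep ≠ 0 := fun h0 => hw ((hzero w).2 h0)
  set c := σ (h w p.rep / h w r.rep) with hc
  have hcσ : σ c = h w p.rep / h w r.rep := hσσ _
  have hx : p.rep - c • r.rep = 0 := by
    refine hh.nondegenerate _ fun y => hh.eq_zero_comm.1 ?_
    have h1 : h (y - (h y p.rep / h w p.rep) • w) p.rep = 0 := by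
      simp [div_mul_cancel₀ _ hw]
    have h2 := (hzero _).1 h1
    have h3 : h w (p.rep - c • r.rep) = 0 := by
      simp [LinearMap.map_smulₛₗ, hcσ, div_mul_cancel₀ _ hwr]
    have h4 : h (y - (h y p.rep / h w p.rep) • w) (p.rep - c • r.rep) = 0 := by
      rw [map_sub (h _), LinearMap.map_smulₛₗ, h1, h2, smul_zero, sub_zero]
    rw [map_sub h, LinearMap.sub_apply, map_smul, LinearMap.smul_apply, h3, smul_zero,
      sub_zero] at h4
    exact h4
  rw [← p.mk_rep, ← r.mk_rep]
  exact (Projectivization.mk_eq_mk_iff' F _ _ _ _).2 ⟨c, (sub_eq_zero.1 hx).symm⟩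

/-- The only absolute point on the polar line of an absolute point is the point itself. -/
theorem eq_of_isAbsolutePoint (hσσ : ∀ x, σ (σ x) = x) {p r : PGPoint F}
    (hp : IsAbsolutePoint π p) (hr : IsAbsolutePoint π r) (hpr : PGOn p (π r)) : p = r := by
  by_contra hne
  refine hne (polarity_injective hh hπ hσσ ((existsUnique_line hne).unique ⟨hp, ?_⟩ ⟨hpr, hr⟩))
  exact (pgOn_polarity_comm hh hπ).1 hpr

/-- The line is the polar of a non-isotropic point, so it has an orthonormal basis v₁, v₂; its
absolute points are v₁ + c·v₂ with c^(q+1) = -1. -/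
theorem ncard_absolutePoints_on_line [Finite F] (hσ : ∀ x, σ x = x ^ q)
    (hF : Nat.card F = q ^ 2) (hq : 2 ≤ q) {L : PGLine F} (hL : ¬ IsAbsoluteLine π L) :
    {p : PGPoint F | IsAbsolutePoint π p ∧ PGOn p L}.ncard = q + 1 := by
  obtain ⟨s, rfl⟩ := polarity_surjective hh hπ L
  have hs : h s.rep s.rep ≠ 0 := fun h0 => hL ⟨s, rfl, (pgOn_polarity_iff hπ).2 h0⟩
  obtain ⟨a, ha, hv₀⟩ := hh.exists_smul_norm_one hσ hF hs
  obtain ⟨v₁, v₂, he⟩ := exists_orthonormal_three hh hσ hF hq (by simp) hv₀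
  set v₀ := a • s.rep with hv₀def
  have h11 : h v₁ v₁ = 1 := he 1 1
  have h22 : h v₂ v₂ = 1 := he 2 2
  have h12 : h v₁ v₂ = 0 := he 1 2
  have h21 : h v₂ v₁ = 0 := he 2 1
  have h10 : h v₁ v₀ = 0 := he 1 0
  have h20 : h v₂ v₀ = 0 := he 2 0
  have hσa : σ a ≠ 0 := (map_ne_zero σ).2 ha
  have hsv : ∀ y, h y v₀ = 0 ↔ h y s.rep = 0 := by
    intro y
    rw [hv₀def, LinearMap.map_smulₛₗ, smul_eq_zero_iff_right hσa]
  have hne : ∀ c : F, v₁ + c • v₂ ≠ 0 := by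
    intro c h0
    have := congrArg (fun v => h v v₁) h0
    simp [h11, h21] at this
  rw [← ncard_norm_fibre hF (s := (-1 : F)) (by simp) (by rw [← hσ]; simp),
    ← Set.ncard_image_of_injective (f := fun c : F => Projectivization.mk F (v₁ + c • v₂) (hne c))]
  · congr 1
    ext p
    simp only [Set.mem_ofPred_eq, Set.mem_image]
    rw [IsAbsolutePoint, pgOn_polarity_iff hπ, pgOn_polarity_iff hπ, ← hsv]
    constructor
    · rintro ⟨hpp, hps⟩
      have hsum := he.sum_smul (by simp) p.rep
      rw [Fin.sum_univ_three] at hsum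
      simp only [Matrix.cons_val] at hsum
      rw [hps, zero_smul, zero_add] at hsum
      set x := h p.rep v₁
      set y := h p.rep v₂
      rw [← hsum] at hpp
      have hxy : x * σ x + y * σ y = 0 := by
        simpa [LinearMap.map_smulₛₗ, h11, h12, h21, h22, mul_comm] using hpp
      have hx : x ≠ 0 := by
        intro hx
        rw [hx, zero_mul, zero_add, hσ, ← pow_succ', pow_eq_zero_iff (by omega)] at hxy
        rw [hx, hxy] at hsum
        exact p.rep_nonzero (by rw [← hsum]; simp)
      refine ⟨y / x, ?_, ?_⟩
      · rw [hσ, hσ, ← pow_succ', ← pow_succ'] at hxy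
        rw [div_pow, div_eq_iff (pow_ne_zero _ hx)]
        linear_combination hxy
      · rw [← p.mk_rep]
        refine (Projectivization.mk_eq_mk_iff' F _ _ _ _).2 ⟨x⁻¹, ?_⟩
        rw [← hsum, smul_add, inv_smul_smul₀ hx, smul_smul, div_eq_inv_mul]
    · rintro ⟨c, hc, rfl⟩
      obtain ⟨d, hd⟩ := Projectivization.exists_smul_eq_mk_rep F (v₁ + c • v₂) (hne c)
      rw [← hd]
      have hc' : c * σ c = -1 := by rw [hσ, ← pow_succ', hc]
      constructor
      · have : h (v₁ + c • v₂) (v₁ + c • v₂) = 0 := by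
          simp [LinearMap.map_smulₛₗ, h11, h12, h21, h22]
          linear_combination hc'
        simp only [Units.smul_def, map_smul, LinearMap.smul_apply, LinearMap.map_smulₛₗ, this,
          smul_zero]
      · simp [Units.smul_def, h10, h20]
  · intro c c' hcc
    obtain ⟨d, hd⟩ := (Projectivization.mk_eq_mk_iff' F _ _ _ _).1 hcc
    have e1 := congrArg (fun v => h v v₁) hd
    have e2 := congrArg (fun v => h v v₂) hd
    simp [h11, h21, h12, h22] at e1 e2
    rw [e1, one_mul] at e2
    exact e2.symm

theorem isAbsoluteLine_polarity_iff (hσσ : ∀ x, σ (σ x) = x) {r : PGPoint F} :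
    IsAbsoluteLine π (π r) ↔ IsAbsolutePoint π r := by
  constructor
  · rintro ⟨s, hs, hsr⟩
    rw [polarity_injective hh hπ hσσ hs] at hsr
    exact hsr
  · exact fun hr => ⟨r, rfl, hr⟩

theorem ncard_mem_classicalUnitalBlocks [Finite F] (hσ : ∀ x, σ x = x ^ q)
    (hF : Nat.card F = q ^ 2) (hq : 2 ≤ q) {B : Set (ClassicalUnitalPoint π)}
    (hB : B ∈ classicalUnitalBlocks π) : B.ncard = q + 1 := by
  obtain ⟨L, hL, rfl⟩ := hB
  rw [← ncard_absolutePoints_on_line hh hπ hσ hF hq hL,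
    ← Set.ncard_image_of_injective _ Subtype.val_injective]
  congr 1
  ext p
  simp [and_comm]

/-- The line joining two absolute points is non-absolute: otherwise both points would equal its
pole. -/
theorem existsUnique_block (hσσ : ∀ x, σ (σ x) = x) {p r : ClassicalUnitalPoint π} (hpr : p ≠ r) :
    ∃! B, B ∈ classicalUnitalBlocks π ∧ p ∈ B ∧ r ∈ B := by
  obtain ⟨L, ⟨hp, hr⟩, huniq⟩ := existsUnique_line (fun h => hpr (Subtype.ext h) : p.1 ≠ r.1)
  refine ⟨_, ⟨⟨L, ?_, rfl⟩, hp, hr⟩, ?_⟩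
  · rintro ⟨s, rfl, hs⟩
    refine hpr (Subtype.ext ?_)
    rw [eq_of_isAbsolutePoint hh hπ hσσ p.2 hs hp, eq_of_isAbsolutePoint hh hπ hσσ r.2 hs hr]
  · rintro _ ⟨⟨L', -, rfl⟩, hp', hr'⟩
    rw [huniq L' ⟨hp', hr'⟩]

/-- The non-absolute lines through p are the polars of the q² points other than p on the polar line
of p. Distinct lines give distinct blocks, as each block has at least two points. -/
theorem ncard_blocks_through [Finite F] (hσ : ∀ x, σ x = x ^ q) (hσσ : ∀ x, σ (σ x) = x)
    (hF : Nat.card F = q ^ 2) (hq : 2 ≤ q) (p : ClassicalUnitalPoint π) :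
    {B | B ∈ classicalUnitalBlocks π ∧ p ∈ B}.ncard = q ^ 2 := by
  have hcard : ({r : PGPoint F | PGOn r (π p.1)} \ {p.1}).ncard = q ^ 2 := by
    rw [Set.ncard_sdiff_singleton_of_mem (show PGOn p.1 (π p.1) from p.2), ncard_points_on_line, hF]
    rfl
  have hnot : ∀ r ∈ {r : PGPoint F | PGOn r (π p.1)} \ {p.1}, ¬ IsAbsoluteLine π (π r) := by
    rintro r ⟨hr, hrp⟩ hab
    rw [isAbsoluteLine_polarity_iff hh hπ hσσ] at hab
    exact hrp (eq_of_isAbsolutePoint hh hπ hσσ hab p.2 hr)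
  rw [← hcard]
  symm
  refine Set.ncard_congr (fun r _ => {x : ClassicalUnitalPoint π | PGOn x.1 (π r)}) ?_ ?_ ?_
  · intro r hr
    exact ⟨⟨π r, hnot r hr, rfl⟩, (pgOn_polarity_comm hh hπ).1 hr.1⟩
  · intro r r' hr hr' heq
    have h2 := ncard_mem_classicalUnitalBlocks hh hπ hσ hF hq ⟨π r, hnot r hr, rfl⟩
    obtain ⟨a, b, ha, hb, hab⟩ := (Set.one_lt_ncard_iff (Set.toFinite _)).1
      (show 1 < ({x : ClassicalUnitalPoint π | PGOn x.1 (π r)}).ncard by rw [h2]; omega)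
    have ha' := ha
    have hb' := hb
    rw [heq] at ha' hb'
    exact polarity_injective hh hπ hσσ
      ((existsUnique_line (fun h => hab (Subtype.ext h) : a.1 ≠ b.1)).unique ⟨ha, hb⟩ ⟨ha', hb'⟩)
  · rintro _ ⟨⟨L, hL, rfl⟩, hp⟩
    obtain ⟨r, rfl⟩ := polarity_surjective hh hπ L
    refine ⟨r, ⟨(pgOn_polarity_comm hh hπ).1 hp, ?_⟩, rfl⟩
    rintro rfl
    exact hL ⟨p.1, rfl, hp⟩

theorem exists_unital_arc [Finite F] (hσ : ∀ x, σ x = x ^ q)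
    (hq : IsPrimePow q) (hF : Nat.card F = q ^ 2) :
    ∃ T : Set (ClassicalUnitalPoint π), q ^ 2 + 1 ≤ T.ncard + q ∧
      ∀ B ∈ classicalUnitalBlocks π, (B ∩ T).ncard ≤ 2 := by
  obtain ⟨A, hA, hcard, harc⟩ := exists_isotropic_arc hh hσ hq hF (by simp)
  refine ⟨{p | p.1 ∈ A}, ?_, ?_⟩
  · have himage : Subtype.val '' {p : ClassicalUnitalPoint π | p.1 ∈ A} = A := by
      ext p
      simp only [Set.mem_image, Set.mem_ofPred_eq, Subtype.exists, exists_and_left, exists_prop,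
        exists_eq_right_right]
      exact ⟨fun h => h.1, fun hp => ⟨hp, (pgOn_polarity_iff hπ).2 (hA p hp)⟩⟩
    rw [← Set.ncard_image_of_injective _ Subtype.val_injective, himage]
    -- This is q³+1 = (q+1)(q²-q+1) without subtraction.
    have : (q + 1) * (q ^ 2 + 1) ≤ (q + 1) * (A.ncard + q) := by nlinarith
    exact Nat.le_of_mul_le_mul_left this (by omega)
  · rintro _ ⟨L, -, rfl⟩
    rw [← Set.ncard_image_of_injective _ Subtype.val_injective]
    refine (Set.ncard_le_ncard ?_ (Set.toFinite _)).trans (harc L.1 L.2)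
    rintro _ ⟨p, ⟨hpL, hpA⟩, rfl⟩
    exact ⟨hpA, hpL⟩

end Polarity

end Unitals

theorem corollary3 (q : ℕ) (hq : IsPrimePow q) (hq2 : 2 < q)
    (F : Type*) [Field F] [Finite F] (hF : Nat.card F = q ^ 2)
    (π : PGPoint F → PGLine F) (hπ : IsUnitaryPolarity q π) :
    vertexIsoperimetricNumber (incidenceGraph (classicalUnitalBlocks π)) =
      2 * ((q : ℝ) ^ 3 + 1 - (⌊unitalC q⌋ : ℝ)) / ((q : ℝ) ^ 2 * ((q : ℝ) ^ 2 + 1)) := by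
  obtain ⟨σ, hσ⟩ := exists_ringHom_eq_pow (K := F) hq hF 1
  simp only [pow_one] at hσ
  have hσσ : ∀ x, σ (σ x) = x := fun x => by
    rw [hσ, hσ, ← pow_mul, ← sq, ← hF, pow_natCard_eq_self]
  obtain ⟨h, hh, hπ'⟩ := exists_hermitianForm hσ hσσ hπ
  obtain ⟨T, hT, harc⟩ := exists_unital_arc hh hπ' hσ hq hF
  exact vertexIsoperimetricNumber_incidenceGraph hq2
    (fun B hB => ncard_mem_classicalUnitalBlocks hh hπ' hσ hF hq2.le hB)
    (ncard_blocks_through hh hπ' hσ hσσ hF hq2.le)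
    (fun p p' hne => existsUnique_block hh hπ' hσσ hne) T hT harc
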